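/- **Setting.** An *O-category* is a category whose hom-sets are dcpos and whose composition is continuous; a functor is *locally continuous* if its action on each hom-set is continuous. An *embedding* is a morphism $e$ for which there is a (unique) $e^p$ with $e^p\circ e=\mathrm{id}$ and $e\circ e^p\sqsubseteq\mathrm{id}$. An *O-colimit* of an $\omega$-chain of embeddings is a cocone of embeddings $\kappa_n$ such that $(\kappa_n\circ\kappa_n^p)_n$ is ascending with supremum $\mathrm{id}$. An O-category *supports canonical fixed points* if it has an initial object $\bot$, has zero morphisms which are the least elements of the hom-sets, and every $\omega$-chain of embeddings has an O-colimit. Let $\mathbf M$ be the O-category of Scott domains (bounded-complete algebraic dcpos with least element and countably many compact elements) and strict continuous functions preserving binary meets, ordered pointwise. Fix an initial object of $\mathbf M$ and an O-colimit for each $\omega$-chain of embeddings. For a locally continuous $F:\mathbf D\times\mathbf M\to\mathbf M$, the functor $F^\dagger:\mathbf D\to\mathbf M$ sends an object $D$ to the vertex of the chosen O-colimit $\phi^{F,D}$ of $\bot\to F_D\bot\to F_D^2\bot\to\cdots$, where $F_D=F(D,-)$. For a natural transformation $\eta:F\Rightarrow G$ put $(\eta^\dagger)_D=\bigsqcup_n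 \phi^{G,D}_n\circ\eta_D^{(n)}\circ(\phi^{F,D}_n)^p$, where $\eta_D=\eta_{(D,-)}:F_D\Rightarrow G_D$ and $\eta_D^{(n)}:F_D^n\bot\to G_D^n\bot$ is the component at $\bot$ of the $n$-fold horizontal iterate; likewise $F^\dagger f$ for $f:D\to D'$ is given by the same formula applied to $F(f,-):F_D\Rightarrow F_{D'}$. Session types over a list $\Xi=\alpha_1,\dots,\alpha_n$ of type variables are generated by: $\Xi\vdash\alpha_i$; and if $\Xi,\alpha\vdash A$ then $\Xi\vdash\rho\alpha.A$ (types are identified up to renaming of bound variables). A type $\Xi\vdash A$ denotes locally continuous functors $⟦A⟧,⟦A⟧^-,⟦A⟧^+:\mathbf M^n\to\mathbf M$ and a natural transformation $⦅A⦆:⟦A⟧\Rightarrow⟦A⟧^-\times⟦A⟧^+$, with components $⦅A⦆^-=\pi_1\circ⦅A⦆$ and $⦅A⦆^+=\pi_2\circ⦅A⦆$. For a variable, the three functors are the projection $\pi_i$ and $⦅\alpha_i⦆=\langle\mathrm{id},\mathrm{id}\rangle$. For $\rho\alpha.A$, regarding $\mathbf M^{n+1}$ as $\mathbf M^n\times\mathbf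 M$, the three functors are $⟦A⟧^\dagger$, $(⟦A⟧^-)^\dagger$, $(⟦A⟧^+)^\dagger$, and $⦅\rho\alpha.A⦆=\langle(⦅A⦆^-)^\dagger,(⦅A⦆^+)^\dagger\rangle$. **Proposition.** $\mathbf M$ supports canonical fixed points, and for every choice of initial object and O-colimits as above: 1. for every $\Xi\vdash A$, each component of $⦅A⦆$ is an embedding in $\mathbf M$; 2. if $\alpha_1,\dots,\alpha_n\vdash A$ and $\Theta\vdash B_i$ for $1\le i\le n$, then, as equalities of functors, $$⟦[\vec B/\vec\alpha]A⟧=⟦A⟧\circ\langle⟦B_i⟧\rangle_{i},\quad ⟦[\vec B/\vec\alpha]A⟧^-=⟦A⟧^-\circ\langle⟦B_i⟧^-\rangle_{i},\quad ⟦[\vec B/\vec\alpha]A⟧^+=⟦A⟧^+\circ\langle⟦B_i⟧^+\rangle_{i};$$ 3. in the situation of 2, the 2-cells compose horizontally, polarity by polarity: $$⦅[\vec B/\vec\alpha]A⦆=\big\langle\,⦅A⦆^-\ast\langle⦅B_i⦆^-\rangle_i,\ ⦅A⦆^+\ast\langle⦅B_i⦆^+\rangle_i\,\big\rangle ,$$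 where $\ast$ is horizontal composition of natural transformations. -/

import Mathlib

open CategoryTheory

universe v v₁ v₂ v₃ u u₁ u₂ u₃

namespace SessionSem

/-! ## Categories whose hom-sets are dcpos -/

/-- An O-category: every hom-set is a dcpo, and composition is (jointly) Scott continuous. -/
class OCategory (K : Type u) [Category.{v} K] where
  homOrder : ∀ X Y : K, PartialOrder (X ⟶ Y)
  exists_isLUB : ∀ {X Y : K} (s : Set (X ⟶ Y)), s.Nonempty → DirectedOn (· ≤ ·) s →
    ∃ f, IsLUB s f
  comp_continuous : ∀ X Y Z : K,
    ScottContinuous (fun p : (X ⟶ Y) × (Y ⟶ Z) => p.1 ≫ p.2)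

attribute [reducible, instance] OCategory.homOrder

section OCategories

variable {K : Type u} [Category.{v} K] [OCategory K]

theorem scottContinuous_comp {α : Type*} [Preorder α] {X Y Z : K} {f : α → (X ⟶ Y)}
    {g : α → (Y ⟶ Z)} (hf : ScottContinuous f) (hg : ScottContinuous g) :
    ScottContinuous fun a => f a ≫ g a :=
  ScottContinuous.comp (hf.prodMk hg) (OCategory.comp_continuous X Y Z)

theorem comp_mono {X Y Z : K} {f f' : X ⟶ Y} {g g' : Y ⟶ Z} (hf : f ≤ f') (hg : g ≤ g') :
    f ≫ g ≤ f' ≫ g' :=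
  (OCategory.comp_continuous X Y Z).monotone (show (f, g) ≤ (f', g') from ⟨hf, hg⟩)

/-- `(e, p)` is an embedding-projection pair. -/
structure IsEPPair {X Y : K} (e : X ⟶ Y) (p : Y ⟶ X) : Prop where
  comp_eq : e ≫ p = 𝟙 X
  comp_le : p ≫ e ≤ 𝟙 Y

/-- `e` is an embedding. -/
def IsEmbedding {X Y : K} (e : X ⟶ Y) : Prop := ∃ p : Y ⟶ X, IsEPPair e p

/-- The projection `e^p` associated with an embedding `e`. -/
noncomputable def IsEmbedding.proj {X Y : K} {e : X ⟶ Y} (h : IsEmbedding e) : Y ⟶ X :=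
  Classical.choose h

theorem IsEmbedding.isEPPair {X Y : K} {e : X ⟶ Y} (h : IsEmbedding e) : IsEPPair e h.proj :=
  Classical.choose_spec h

theorem IsEPPair.unique {X Y : K} {e : X ⟶ Y} {p q : Y ⟶ X} (hp : IsEPPair e p)
    (hq : IsEPPair e q) : p = q := by
  apply le_antisymm
  · calc p = p ≫ e ≫ q := by rw [hq.comp_eq, Category.comp_id]
      _ = (p ≫ e) ≫ q := (Category.assoc _ _ _).symm
      _ ≤ 𝟙 Y ≫ q := comp_mono hp.comp_le le_rfl
      _ = q := Category.id_comp q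
  · calc q = q ≫ e ≫ p := by rw [hp.comp_eq, Category.comp_id]
      _ = (q ≫ e) ≫ p := (Category.assoc _ _ _).symm
      _ ≤ 𝟙 Y ≫ p := comp_mono hq.comp_le le_rfl
      _ = p := Category.id_comp p

theorem IsEPPair.id (X : K) : IsEPPair (𝟙 X) (𝟙 X) :=
  ⟨Category.id_comp _, (Category.id_comp _).le⟩

theorem IsEPPair.comp {X Y Z : K} {e : X ⟶ Y} {p : Y ⟶ X} {e' : Y ⟶ Z} {p' : Z ⟶ Y}
    (h : IsEPPair e p) (h' : IsEPPair e' p') : IsEPPair (e ≫ e') (p' ≫ p) := by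
  constructor
  · calc (e ≫ e') ≫ p' ≫ p = e ≫ (e' ≫ p') ≫ p := by simp only [Category.assoc]
      _ = 𝟙 X := by rw [h'.comp_eq, Category.id_comp, h.comp_eq]
  · calc (p' ≫ p) ≫ e ≫ e' = p' ≫ (p ≫ e) ≫ e' := by simp only [Category.assoc]
      _ ≤ p' ≫ 𝟙 Y ≫ e' := comp_mono le_rfl (comp_mono h.comp_le le_rfl)
      _ = p' ≫ e' := by rw [Category.id_comp]
      _ ≤ 𝟙 Z := h'.comp_le

theorem IsEmbedding.comp {X Y Z : K} {e : X ⟶ Y} {e' : Y ⟶ Z} (h : IsEmbedding e)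
    (h' : IsEmbedding e') : IsEmbedding (e ≫ e') :=
  ⟨_, h.isEPPair.comp h'.isEPPair⟩

variable (K) in
/-- An ω-chain in the subcategory of embeddings. -/
structure EmbChain where
  functor : ℕ ⥤ K
  isEmbedding : ∀ {m n : ℕ} (f : m ⟶ n), IsEmbedding (functor.map f)

/-- An O-colimit of a chain of embeddings: a cocone of embeddings `κ` such that the
`κ_n ∘ κ_n^p` form an ascending chain with supremum the identity. -/
structure OColimit (J : EmbChain K) where
  cocone : Limits.Cocone J.functor
  isEmbedding : ∀ n, IsEmbedding (cocone.ι.app n)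
  ascending : Monotone fun n => (isEmbedding n).proj ≫ cocone.ι.app n
  isLUB : IsLUB (Set.range fun n => (isEmbedding n).proj ≫ cocone.ι.app n) (𝟙 cocone.pt)

variable (K) in
/-- Strict morphisms: the zero morphisms are the least elements of the hom-sets. -/
class HasStrictMorphisms [Limits.HasZeroMorphisms K] : Prop where
  zero_le : ∀ {X Y : K} (f : X ⟶ Y), (0 : X ⟶ Y) ≤ f

variable (K) in
/-- `K` has an initial object, has strict morphisms, and is O-cocomplete. -/
structure SupportsCanonicalFixedPoints [Limits.HasZeroMorphisms K] : Prop where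
  hasInitial : Limits.HasInitial K
  strict : HasStrictMorphisms K
  ocomplete : ∀ J : EmbChain K, Nonempty (OColimit J)

variable (K) in
/-- A choice of the data from which canonical fixed points are computed: an initial object, and
an O-colimit for every chain of embeddings. -/
structure FixChoice where
  bot : K
  isInitial : Limits.IsInitial bot
  colim : ∀ J : EmbChain K, OColimit J

end OCategories

/-! ## Products of O-categories and locally continuous functors -/

instance prodOCategory {C : Type u₁} [Category.{v₁} C] [OCategory C]
    {D : Type u₂} [Category.{v₂} D] [OCategory D] : OCategory (C × D) where
  homOrder X Y := Prod.instPartialOrder (X.1 ⟶ Y.1) (X.2 ⟶ Y.2)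
  exists_isLUB {X Y} s hs hd := by
    obtain ⟨f, hf⟩ := OCategory.exists_isLUB
      ((Prod.fst : (X.1 ⟶ Y.1) × (X.2 ⟶ Y.2) → _) '' s) (hs.image _) (DirectedOn.fst hd)
    obtain ⟨g, hg⟩ := OCategory.exists_isLUB
      ((Prod.snd : (X.1 ⟶ Y.1) × (X.2 ⟶ Y.2) → _) '' s) (hs.image _) (DirectedOn.snd hd)
    exact ⟨(f, g), isLUB_prod.2 ⟨hf, hg⟩⟩
  comp_continuous X Y Z :=
    ScottContinuous.prodMk
      (α := ((X.1 ⟶ Y.1) × (X.2 ⟶ Y.2)) × ((Y.1 ⟶ Z.1) × (Y.2 ⟶ Z.2)))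
      (scottContinuous_comp (X := X.1) (Y := Y.1) (Z := Z.1)
        (f := fun p : ((X.1 ⟶ Y.1) × (X.2 ⟶ Y.2)) × ((Y.1 ⟶ Z.1) × (Y.2 ⟶ Z.2)) => p.1.1)
        (g := fun p => p.2.1) (ScottContinuous.fst.comp ScottContinuous.fst)
        (ScottContinuous.snd.comp ScottContinuous.fst))
      (scottContinuous_comp (X := X.2) (Y := Y.2) (Z := Z.2)
        (f := fun p : ((X.1 ⟶ Y.1) × (X.2 ⟶ Y.2)) × ((Y.1 ⟶ Z.1) × (Y.2 ⟶ Z.2)) => p.1.2)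
        (g := fun p => p.2.2) (ScottContinuous.fst.comp ScottContinuous.snd)
        (ScottContinuous.snd.comp ScottContinuous.snd))

theorem scottContinuous_pi {α : Type*} [Preorder α] {ι : Type*} {π : ι → Type*}
    [∀ i, Preorder (π i)] {f : α → ∀ i, π i} (h : ∀ i, ScottContinuous fun a => f a i) :
    ScottContinuous f := by
  intro d hd hd' a ha
  refine isLUB_pi.2 fun i => ?_
  have := h i hd hd' ha
  rwa [Set.image_image]

theorem scottContinuous_eval {ι : Type*} {π : ι → Type*} [∀ i, Preorder (π i)] (i : ι) :
    ScottContinuous fun f : ∀ i, π i => f i :=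
  fun _ _ _ _ ha => isLUB_pi.1 ha i

instance piOCategory {ι : Type} {D : Type u₂} [Category.{v₂} D] [OCategory D] :
    OCategory (ι → D) where
  homOrder X Y := Pi.partialOrder (ι := ι) (π := fun i => X i ⟶ Y i)
  exists_isLUB {X Y} s hs hd := by
    have h : ∀ i, ∃ f, IsLUB (Function.eval i '' (s : Set (∀ i, X i ⟶ Y i))) f := fun i =>
      OCategory.exists_isLUB _ (hs.image _) (by
        rintro _ ⟨a, ha, rfl⟩ _ ⟨b, hb, rfl⟩
        obtain ⟨c, hc, hac, hbc⟩ := hd a ha b hb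
        exact ⟨_, ⟨c, hc, rfl⟩, hac i, hbc i⟩)
    choose f hf using h
    exact ⟨f, isLUB_pi.2 hf⟩
  comp_continuous X Y Z :=
    scottContinuous_pi (α := (∀ i, X i ⟶ Y i) × (∀ i, Y i ⟶ Z i)) fun i =>
      scottContinuous_comp (ScottContinuous.fst.comp (scottContinuous_eval i))
        (ScottContinuous.snd.comp (scottContinuous_eval i))

/-- Locally continuous functors between O-categories. -/
structure LCFunctor (C : Type u₁) [Category.{v₁} C] [OCategory C]
    (D : Type u₂) [Category.{v₂} D] [OCategory D] extends C ⥤ D where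
  scottContinuous_map : ∀ X Y : C, ScottContinuous fun f : X ⟶ Y => toFunctor.map f

namespace LCFunctor

variable {C : Type u₁} [Category.{v₁} C] [OCategory C]
  {D : Type u₂} [Category.{v₂} D] [OCategory D]
  {E : Type u₃} [Category.{v₃} E] [OCategory E]

theorem map_isEPPair (F : LCFunctor C D) {X Y : C} {e : X ⟶ Y} {p : Y ⟶ X} (h : IsEPPair e p) :
    IsEPPair (F.map e) (F.map p) where
  comp_eq := by rw [← F.map_comp, h.comp_eq, F.map_id]
  comp_le := by
    rw [← F.map_comp, ← F.map_id]
    exact (F.scottContinuous_map Y Y).monotone h.comp_le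

/-- Composition, in diagrammatic order: `F` first. -/
def comp (F : LCFunctor C D) (G : LCFunctor D E) : LCFunctor C E where
  toFunctor := F.toFunctor ⋙ G.toFunctor
  scottContinuous_map X Y :=
    (F.scottContinuous_map X Y).comp (G.scottContinuous_map (F.obj X) (F.obj Y))

/-- The projection functors out of a power. -/
def eval {ι : Type} (i : ι) : LCFunctor (ι → D) D where
  toFunctor := Pi.eval (fun _ => D) i
  scottContinuous_map X Y := scottContinuous_eval (π := fun i => X i ⟶ Y i) i

/-- The tuple of a family of functors. -/
def tuple {ι : Type} (F : ι → LCFunctor C D) : LCFunctor C (ι → D) where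
  toFunctor := Functor.pi' fun i => (F i).toFunctor
  scottContinuous_map X Y :=
    scottContinuous_pi (π := fun i => (F i).obj X ⟶ (F i).obj Y)
      fun i => (F i).scottContinuous_map X Y

variable (C D) in
/-- First projection. -/
def fst : LCFunctor (C × D) C where
  toFunctor := CategoryTheory.Prod.fst C D
  scottContinuous_map X Y :=
    ScottContinuous.fst (α := X.1 ⟶ Y.1) (β := X.2 ⟶ Y.2)

variable (C D) in
/-- Second projection. -/
def snd : LCFunctor (C × D) D where
  toFunctor := CategoryTheory.Prod.snd C D
  scottContinuous_map X Y :=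
    ScottContinuous.snd (α := X.1 ⟶ Y.1) (β := X.2 ⟶ Y.2)

variable (D) in
/-- The isomorphism of categories `D^n × D → D^(n+1)`. The last factor on the left becomes the
component with index `0` on the right, the `i`-th component of the first factor the component
with index `i + 1`. -/
def extend (n : ℕ) : LCFunctor ((Fin n → D) × D) (Fin (n + 1) → D) :=
  tuple (Fin.cases (snd _ _) fun i => (fst _ _).comp (eval i))

/-- The partial application `F_X = F(X, -)`. -/
def partialApp (F : LCFunctor (D × E) E) (X : D) : LCFunctor E E where
  toFunctor := (Functor.curry.obj F.toFunctor).obj X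
  scottContinuous_map Y Z :=
    ScottContinuous.comp (α := Y ⟶ Z) (β := (X ⟶ X) × (Y ⟶ Z)) (f := fun g => (𝟙 X, g))
      (ScottContinuous.prodMk (ScottContinuous.const (𝟙 X)) ScottContinuous.id)
      (F.scottContinuous_map (X, Y) (X, Z))

end LCFunctor

/-! ## Canonical fixed points -/

section Fix

variable {E : Type u} [Category.{v} E]

/-- `F^n X` -/
def iterObj (F : E ⥤ E) (X : E) : ℕ → E
  | 0 => X
  | n + 1 => F.obj (iterObj F X n)

/-- `F^n k : F^n X ⟶ F^(n+1) X` -/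
def iterLink (F : E ⥤ E) {X : E} (k : X ⟶ F.obj X) :
    ∀ n : ℕ, iterObj F X n ⟶ iterObj F X (n + 1)
  | 0 => k
  | n + 1 => F.map (iterLink F k n)

/-- The component at `X` of the horizontal iterate `η^(n) : F^n ⟶ G^n`, where
`η^(n+1) = η ∗ η^(n)`. -/
def iterTrans {F G : E ⥤ E} (η : F ⟶ G) (X : E) : ∀ n : ℕ, iterObj F X n ⟶ iterObj G X n
  | 0 => 𝟙 X
  | n + 1 => F.map (iterTrans η X n) ≫ η.app (iterObj G X n)

theorem iterTrans_id (F : E ⥤ E) (X : E) (n : ℕ) : iterTrans (𝟙 F) X n = 𝟙 _ := by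
  induction n with
  | zero => rfl
  | succ n ih =>
    change F.map (iterTrans (𝟙 F) X n) ≫ 𝟙 (F.obj (iterObj F X n)) = 𝟙 (F.obj (iterObj F X n))
    rw [ih, F.map_id, Category.comp_id]

theorem iterTrans_comp {F G H : E ⥤ E} (η : F ⟶ G) (θ : G ⟶ H) (X : E) (n : ℕ) :
    iterTrans (η ≫ θ) X n = iterTrans η X n ≫ iterTrans θ X n := by
  induction n with
  | zero => exact (Category.id_comp _).symm
  | succ n ih =>
    change F.map (iterTrans (η ≫ θ) X n) ≫ η.app _ ≫ θ.app _ =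
      (F.map _ ≫ η.app _) ≫ G.map _ ≫ θ.app _
    rw [ih, F.map_comp]
    simp only [Category.assoc, NatTrans.naturality_assoc]

variable [OCategory E] (c : FixChoice E)

variable {c} in
theorem iterLink_iterTrans {F G : LCFunctor E E} (η : F.toFunctor ⟶ G.toFunctor) (n : ℕ) :
    iterLink F.toFunctor (c.isInitial.to (F.obj c.bot)) n ≫ iterTrans η c.bot (n + 1) =
      iterTrans η c.bot n ≫ iterLink G.toFunctor (c.isInitial.to (G.obj c.bot)) n := by
  induction n with
  | zero => exact c.isInitial.hom_ext _ _
  | succ n ih =>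
    change F.map _ ≫ F.map _ ≫ η.app _ = (F.map _ ≫ η.app _) ≫ G.map _
    rw [← F.map_comp_assoc, ih, F.map_comp, Category.assoc, Category.assoc, η.naturality]

variable [Limits.HasZeroMorphisms E] [HasStrictMorphisms E]

theorem isEmbedding_to (X : E) : IsEmbedding (c.isInitial.to X) :=
  ⟨0, c.isInitial.hom_ext _ _, by
    rw [Limits.zero_comp]; exact HasStrictMorphisms.zero_le _⟩

theorem isEmbedding_iterLink (F : LCFunctor E E) (n : ℕ) :
    IsEmbedding (iterLink F.toFunctor (c.isInitial.to (F.obj c.bot)) n) := by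
  induction n with
  | zero => exact isEmbedding_to c _
  | succ n ih => exact ⟨_, F.map_isEPPair ih.isEPPair⟩

/-- The chain `⊥ ⟶ F ⊥ ⟶ F² ⊥ ⟶ ⋯`. -/
def fixChain (F : LCFunctor E E) : EmbChain E where
  functor := Functor.ofSequence (iterLink F.toFunctor (c.isInitial.to (F.obj c.bot)))
  isEmbedding {m n} f := by
    obtain ⟨k, rfl⟩ := Nat.exists_eq_add_of_le (leOfHom f)
    obtain rfl := Subsingleton.elim f (homOfLE (Nat.le_add_right m k))
    induction k with
    | zero => exact ⟨𝟙 _, by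
        have : homOfLE (Nat.le_add_right m 0) = 𝟙 m := rfl
        rw [this, CategoryTheory.Functor.map_id]; exact IsEPPair.id _⟩
    | succ k ih =>
      have : homOfLE (Nat.le_add_right m (k + 1)) =
        homOfLE (Nat.le_add_right m k) ≫ homOfLE (Nat.le_add_right (m + k) 1) := rfl
      rw [this, Functor.map_comp, Functor.ofSequence_map_homOfLE_succ]
      exact ih.comp (isEmbedding_iterLink c F _)

/-- The canonical fixed point of `F`. -/
def fixObj (F : LCFunctor E E) : E := (c.colim (fixChain c F)).cocone.pt

/-- The legs `κ_n : F^n ⊥ ⟶ FIX F` of the chosen O-colimit. -/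
def fixLeg (F : LCFunctor E E) (n : ℕ) : iterObj F.toFunctor c.bot n ⟶ fixObj c F :=
  (c.colim (fixChain c F)).cocone.ι.app n

theorem isEmbedding_fixLeg (F : LCFunctor E E) (n : ℕ) : IsEmbedding (fixLeg c F n) :=
  (c.colim (fixChain c F)).isEmbedding n

/-- The projections `κ_n^p : FIX F ⟶ F^n ⊥`. -/
noncomputable def fixProj (F : LCFunctor E E) (n : ℕ) :
    fixObj c F ⟶ iterObj F.toFunctor c.bot n :=
  (isEmbedding_fixLeg c F n).proj

theorem isEPPair_fix (F : LCFunctor E E) (n : ℕ) : IsEPPair (fixLeg c F n) (fixProj c F n) :=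
  (isEmbedding_fixLeg c F n).isEPPair

theorem iterLink_fixLeg (F : LCFunctor E E) (n : ℕ) :
    iterLink F.toFunctor (c.isInitial.to (F.obj c.bot)) n ≫ fixLeg c F (n + 1) = fixLeg c F n := by
  have h := (c.colim (fixChain c F)).cocone.w (homOfLE (Nat.le_add_right n 1))
  have h' : (fixChain c F).functor.map (homOfLE (Nat.le_add_right n 1)) =
    iterLink F.toFunctor (c.isInitial.to (F.obj c.bot)) n :=
    Functor.ofSequence_map_homOfLE_succ _ n
  rw [h'] at h
  exact h

/-- `γ_n ∘ η^(n) ∘ φ_n^p : FIX F ⟶ FIX G`, where `φ` and `γ` are the chosen O-colimits. -/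
noncomputable def fixApprox {F G : LCFunctor E E} (η : F.toFunctor ⟶ G.toFunctor) (n : ℕ) :
    fixObj c F ⟶ fixObj c G :=
  fixProj c F n ≫ iterTrans η c.bot n ≫ fixLeg c G n

theorem monotone_fixApprox {F G : LCFunctor E E} (η : F.toFunctor ⟶ G.toFunctor) :
    Monotone (fixApprox c η) := by
  refine monotone_nat_of_le_succ fun n => ?_
  obtain ⟨p, hp⟩ := isEmbedding_iterLink c F n
  have h : fixProj c F n = fixProj c F (n + 1) ≫ p := by
    have h1 := hp.comp (isEPPair_fix c F (n + 1))
    rw [iterLink_fixLeg] at h1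
    exact (isEPPair_fix c F n).unique h1
  calc fixApprox c η n
      = fixProj c F (n + 1) ≫ (p ≫ iterLink F.toFunctor (c.isInitial.to (F.obj c.bot)) n) ≫
          iterTrans η c.bot (n + 1) ≫ fixLeg c G (n + 1) := by
        rw [fixApprox, h, ← iterLink_fixLeg c G]
        simp only [Category.assoc]
        rw [← Category.assoc (iterLink _ _ n), iterLink_iterTrans, Category.assoc]
    _ ≤ fixProj c F (n + 1) ≫ 𝟙 _ ≫ iterTrans η c.bot (n + 1) ≫ fixLeg c G (n + 1) :=
        comp_mono le_rfl (comp_mono hp.comp_le le_rfl)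
    _ = fixApprox c η (n + 1) := by rw [Category.id_comp]; rfl

theorem exists_isLUB_fixApprox {F G : LCFunctor E E} (η : F.toFunctor ⟶ G.toFunctor) :
    ∃ f, IsLUB (Set.range (fixApprox c η)) f :=
  OCategory.exists_isLUB _ (Set.range_nonempty _)
    (monotone_fixApprox c η).directed_le.directedOn_range

/-- `FIX η = ⨆ n, γ_n ∘ η^(n) ∘ φ_n^p`. -/
noncomputable def fixMap {F G : LCFunctor E E} (η : F.toFunctor ⟶ G.toFunctor) :
    fixObj c F ⟶ fixObj c G :=
  Classical.choose (exists_isLUB_fixApprox c η)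

theorem isLUB_fixMap {F G : LCFunctor E E} (η : F.toFunctor ⟶ G.toFunctor) :
    IsLUB (Set.range (fixApprox c η)) (fixMap c η) :=
  Classical.choose_spec (exists_isLUB_fixApprox c η)

theorem fixMap_id (F : LCFunctor E E) : fixMap c (𝟙 F.toFunctor) = 𝟙 (fixObj c F) := by
  refine (isLUB_fixMap c _).unique ?_
  have h := (c.colim (fixChain c F)).isLUB
  have hn : fixApprox c (𝟙 F.toFunctor) = fun n => fixProj c F n ≫ fixLeg c F n := by
    funext n
    rw [fixApprox, iterTrans_id, Category.id_comp]
  rw [hn]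
  exact h

theorem fixMap_comp {F G H : LCFunctor E E} (η : F.toFunctor ⟶ G.toFunctor)
    (θ : G.toFunctor ⟶ H.toFunctor) : fixMap c (η ≫ θ) = fixMap c η ≫ fixMap c θ := by
  refine (isLUB_fixMap c _).unique ?_
  have hl : IsLUB (Set.range fun n => (fixApprox c η n, fixApprox c θ n))
      (fixMap c η, fixMap c θ) := by
    refine isLUB_prod.2 ⟨?_, ?_⟩
    · rw [← Set.range_comp]; exact isLUB_fixMap c η
    · rw [← Set.range_comp]; exact isLUB_fixMap c θ
  have h := OCategory.comp_continuous _ _ _ (Set.range_nonempty _)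
    ((monotone_fixApprox c η).prodMk (monotone_fixApprox c θ)).directed_le.directedOn_range hl
  rw [← Set.range_comp] at h
  have hn : fixApprox c (η ≫ θ) = fun n => fixApprox c η n ≫ fixApprox c θ n := by
    funext n
    simp only [fixApprox, Category.assoc, iterTrans_comp]
    rw [← Category.assoc (fixLeg c G n), (isEPPair_fix c G n).comp_eq, Category.id_comp]
  rw [hn]
  exact h

end Fix

/-! ## The dagger -/

section Dagger

variable {D : Type u₁} [Category.{v₁} D] [OCategory D]
  {E : Type u} [Category.{v} E] [OCategory E]

/-- `Λ F f : F_X ⟶ F_Y` for `f : X ⟶ Y`. -/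
def partialMap (F : LCFunctor (D × E) E) {X Y : D} (f : X ⟶ Y) :
    (F.partialApp X).toFunctor ⟶ (F.partialApp Y).toFunctor :=
  (Functor.curry.obj F.toFunctor).map f

/-- `(Λ η)_X : F_X ⟶ G_X` for `η : F ⟶ G`. -/
def partialTrans {F G : LCFunctor (D × E) E} (η : F.toFunctor ⟶ G.toFunctor) (X : D) :
    (F.partialApp X).toFunctor ⟶ (G.partialApp X).toFunctor :=
  (Functor.curry.map η).app X

theorem scottContinuous_iterTrans (F : LCFunctor (D × E) E) (X Y : D) (Z : E) (n : ℕ) :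
    ScottContinuous fun f : X ⟶ Y => iterTrans (partialMap F f) Z n := by
  induction n with
  | zero => exact ScottContinuous.const _
  | succ n ih =>
    refine scottContinuous_comp
      (ih.comp ((F.partialApp X).scottContinuous_map _ _)) ?_
    exact ScottContinuous.comp
      (ScottContinuous.prodMk (β := X ⟶ Y) ScottContinuous.id (ScottContinuous.const (𝟙 _)))
      (F.scottContinuous_map _ _)

variable [Limits.HasZeroMorphisms E] [HasStrictMorphisms E] (c : FixChoice E)

/-- The parametrized fixed point `F† : D ⟶ E` of `F : D × E ⟶ E`, with `F† X = FIX F_X`. -/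
noncomputable def dagger (F : LCFunctor (D × E) E) : LCFunctor D E where
  obj X := fixObj c (F.partialApp X)
  map f := fixMap c (partialMap F f)
  map_id X := by
    have h : partialMap F (𝟙 X) = 𝟙 (F.partialApp X).toFunctor :=
      (Functor.curry.obj F.toFunctor).map_id X
    rw [h, fixMap_id]
  map_comp {X Y Z} f g := by
    have h : partialMap F (f ≫ g) = partialMap F f ≫ partialMap F g :=
      (Functor.curry.obj F.toFunctor).map_comp f g
    rw [h, fixMap_comp]
  scottContinuous_map X Y := by
    have hc : ∀ n, ScottContinuous fun f : X ⟶ Y => fixApprox c (partialMap F f) n := fun n =>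
      scottContinuous_comp (ScottContinuous.const _)
        (scottContinuous_comp (scottContinuous_iterTrans F X Y c.bot n) (ScottContinuous.const _))
    intro s hs hd f hf
    constructor
    · rintro _ ⟨g, hg, rfl⟩
      refine (isLUB_fixMap c _).2 ?_
      rintro _ ⟨n, rfl⟩
      exact ((hc n).monotone (hf.1 hg)).trans ((isLUB_fixMap c (partialMap F f)).1 ⟨n, rfl⟩)
    · intro b hb
      refine (isLUB_fixMap c _).2 ?_
      rintro _ ⟨n, rfl⟩
      refine (hc n hs hd hf).2 ?_
      rintro _ ⟨g, hg, rfl⟩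
      exact ((isLUB_fixMap c (partialMap F g)).1 ⟨n, rfl⟩).trans (hb ⟨g, hg, rfl⟩)

/-- The action of the dagger on natural transformations: `(η†)_X = FIX ((Λ η)_X)`. -/
noncomputable def daggerMap {F G : LCFunctor (D × E) E} (η : F.toFunctor ⟶ G.toFunctor) :
    (dagger c F).toFunctor ⟶ (dagger c G).toFunctor where
  app X := fixMap c (partialTrans η X)
  naturality X Y f := by
    change fixMap c (partialMap F f) ≫ fixMap c (partialTrans η Y) =
      fixMap c (partialTrans η X) ≫ fixMap c (partialMap G f)
    rw [← fixMap_comp, ← fixMap_comp]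
    congr 1
    exact (Functor.curry.map η).naturality f

end Dagger

/-! ## The O-category of Scott domains -/

/-- Scott domains: pointed bounded-complete algebraic dcpos with countably many compact elements. -/
class IsScottDomain (D : Type u) [PartialOrder D] [OrderBot D] : Prop where
  directedComplete : ∀ s : Set D, s.Nonempty → DirectedOn (· ≤ ·) s → ∃ x, IsLUB s x
  boundedComplete : ∀ s : Set D, BddAbove s → ∃ x, IsLUB s x
  directedOn_compact : ∀ x : D, DirectedOn (· ≤ ·) {k : D | IsCompactElement k ∧ k ≤ x}
  isLUB_compact : ∀ x : D, IsLUB {k : D | IsCompactElement k ∧ k ≤ x} x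
  countable_compact : {k : D | IsCompactElement k}.Countable

/-- The objects of the category `M`. -/
structure ScottDom : Type (u + 1) where
  carrier : Type u
  [partialOrder : PartialOrder carrier]
  [orderBot : OrderBot carrier]
  [isScottDomain : IsScottDomain carrier]

namespace ScottDom

instance : CoeSort ScottDom.{u} (Type u) := ⟨carrier⟩

attribute [instance] partialOrder orderBot isScottDomain

/-- The morphisms of `M`: strict continuous functions that preserve binary meets (in a Scott
domain all binary meets exist). -/
@[ext]
structure Hom (D E : ScottDom.{u}) where
  toFun : D → E
  strict : toFun ⊥ = ⊥
  continuous : ScottContinuous toFun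
  map_meet : ∀ x y z : D, IsGLB {x, y} z → IsGLB {toFun x, toFun y} (toFun z)

instance : Category ScottDom.{u} where
  Hom := Hom
  id D := ⟨fun x => x, rfl, ScottContinuous.id, fun _ _ _ h => h⟩
  comp f g :=
    { toFun := fun x => g.toFun (f.toFun x)
      strict := by rw [f.strict, g.strict]
      continuous := f.continuous.comp g.continuous
      map_meet := fun _ _ _ h => g.map_meet _ _ _ (f.map_meet _ _ _ h) }

theorem hom_ext {D E : ScottDom.{u}} {f g : D ⟶ E} (h : ∀ x, f.toFun x = g.toFun x) : f = g :=
  Hom.ext (funext h)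

/-- Morphisms are ordered pointwise. -/
@[reducible]
def homOrder (D E : ScottDom.{u}) : PartialOrder (D ⟶ E) :=
  PartialOrder.lift (fun f => f.toFun) fun _ _ h => Hom.ext h

theorem exists_isLUB_hom {D E : ScottDom.{u}} (s : Set (D ⟶ E)) (hs : s.Nonempty)
    (hd : DirectedOn (homOrder D E).le s) :
    ∃ f : D ⟶ E, ∀ x, IsLUB ((fun g : D ⟶ E => g.toFun x) '' s) (f.toFun x) := by
  have h : ∀ x : D, ∃ y : E, IsLUB ((fun g : D ⟶ E => g.toFun x) '' s) y := fun x =>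
    IsScottDomain.directedComplete _ (hs.image _) (by
      rintro _ ⟨a, ha, rfl⟩ _ ⟨b, hb, rfl⟩
      obtain ⟨c, hc, hac, hbc⟩ := hd a ha b hb
      exact ⟨_, ⟨c, hc, rfl⟩, hac x, hbc x⟩)
  choose F hF using h
  have mono : Monotone F := fun x y hxy => (hF x).2 (by
    rintro _ ⟨g, hg, rfl⟩
    exact (g.continuous.monotone hxy).trans ((hF y).1 ⟨g, hg, rfl⟩))
  refine ⟨⟨F, ?_, ?_, ?_⟩, hF⟩
  · refine le_antisymm ((hF ⊥).2 ?_) bot_le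
    rintro _ ⟨g, hg, rfl⟩
    exact g.strict.le
  · intro d hd₁ hd₂ a ha
    refine ⟨mono.mem_upperBounds_image ha.1, fun b hb => (hF a).2 ?_⟩
    rintro _ ⟨g, hg, rfl⟩
    refine (g.continuous hd₁ hd₂ ha).2 ?_
    rintro _ ⟨x, hx, rfl⟩
    exact ((hF x).1 ⟨g, hg, rfl⟩).trans (hb ⟨x, hx, rfl⟩)
  · intro x y z hz
    have dir : ∀ x : D, DirectedOn (· ≤ ·) ((fun g : D ⟶ E => g.toFun x) '' s) := by
      rintro x _ ⟨a, ha, rfl⟩ _ ⟨b, hb, rfl⟩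
      obtain ⟨c, hc, hac, hbc⟩ := hd a ha b hb
      exact ⟨_, ⟨c, hc, rfl⟩, hac x, hbc x⟩
    constructor
    · rintro _ (rfl | rfl)
      · exact mono (hz.1 (by simp))
      · exact mono (hz.1 (by simp))
    · intro w hw
      refine (IsScottDomain.isLUB_compact w).2 ?_
      rintro k ⟨hk, hkw⟩
      have hx : k ≤ F x := hkw.trans (hw (by simp))
      have hy : k ≤ F y := hkw.trans (hw (by simp))
      obtain ⟨_, ⟨a, ha, rfl⟩, hka⟩ := hk _ _ (hs.image _) (dir x) (hF x) hx
      obtain ⟨_, ⟨b, hb, rfl⟩, hkb⟩ := hk _ _ (hs.image _) (dir y) (hF y) hy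
      obtain ⟨c, hc, hac, hbc⟩ := hd a ha b hb
      refine le_trans ((c.map_meet x y z hz).2 ?_) ((hF z).1 ⟨c, hc, rfl⟩)
      rintro _ (rfl | rfl)
      · exact hka.trans (hac x)
      · exact hkb.trans (hbc y)

theorem isLUB_hom_iff {D E : ScottDom.{u}} {s : Set (D ⟶ E)} (hs : s.Nonempty)
    (hd : DirectedOn (homOrder D E).le s) {f : D ⟶ E} :
    @IsLUB _ (homOrder D E).toLE s f ↔
      ∀ x, IsLUB ((fun g : D ⟶ E => g.toFun x) '' s) (f.toFun x) := by
  have key : ∀ g : D ⟶ E, (∀ x, IsLUB ((fun g : D ⟶ E => g.toFun x) '' s) (g.toFun x)) →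
      @IsLUB _ (homOrder D E).toLE s g := fun g hg => by
    refine ⟨fun a ha x => (hg x).1 ⟨a, ha, rfl⟩, fun b hb x => (hg x).2 ?_⟩
    rintro _ ⟨a, ha, rfl⟩
    exact hb ha x
  refine ⟨fun hf => ?_, key f⟩
  obtain ⟨g, hg⟩ := exists_isLUB_hom s hs hd
  have : f = g := @IsLUB.unique _ (homOrder D E) _ _ _ hf (key g hg)
  rwa [this]

instance : OCategory ScottDom.{u} where
  homOrder := homOrder
  exists_isLUB s hs hd := by
    obtain ⟨f, hf⟩ := exists_isLUB_hom s hs hd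
    exact ⟨f, (isLUB_hom_iff hs hd).2 hf⟩
  comp_continuous X Y Z := by
    let _ := homOrder X Y
    let _ := homOrder Y Z
    let _ := homOrder X Z
    refine ScottContinuous.fromProd (fun f => ?_) (fun g => ?_)
    · intro s hs hd g hg
      have mono : Monotone fun g : Y ⟶ Z => f ≫ g := fun a b hab x => hab (f.toFun x)
      refine (isLUB_hom_iff (hs.image _) (hd.mono_comp (fun {_ _} h => mono h))).2 fun x => ?_
      have := (isLUB_hom_iff hs hd).1 hg (f.toFun x)
      rwa [Set.image_image]
    · intro s hs hd f hf
      have mono : Monotone fun f : X ⟶ Y => f ≫ g :=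
        fun a b hab x => g.continuous.monotone (hab x)
      refine (isLUB_hom_iff (hs.image _) (hd.mono_comp (fun {_ _} h => mono h))).2 fun x => ?_
      have h := g.continuous (hs.image _) ?_ ((isLUB_hom_iff hs hd).1 hf x)
      · rw [Set.image_image] at h ⊢
        exact h
      · rintro _ ⟨a, ha, rfl⟩ _ ⟨b, hb, rfl⟩
        obtain ⟨c, hc, hac, hbc⟩ := hd a ha b hb
        exact ⟨_, ⟨c, hc, rfl⟩, hac x, hbc x⟩

instance : Limits.HasZeroMorphisms ScottDom.{u} where
  zero D E := ⟨⟨fun _ => ⊥, rfl, ScottContinuous.const ⊥, fun _ _ _ _ => by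
    rw [Set.pair_eq_singleton]; exact isGLB_singleton⟩⟩
  comp_zero _ _ := rfl
  zero_comp _ _ _ g := hom_ext fun _ => g.strict

instance : HasStrictMorphisms ScottDom.{u} where
  zero_le _ := fun _ => bot_le

/-! ### Binary products in `M` -/

theorem isCompactElement_prod_iff {D E : Type u} [PartialOrder D] [PartialOrder E] (k : D × E) :
    IsCompactElement k ↔ IsCompactElement k.1 ∧ IsCompactElement k.2 := by
  constructor
  · intro h
    constructor
    · intro s a hs hd ha hk
      obtain ⟨x, hx, hkx⟩ := h (s ×ˢ {k.2}) (a, k.2) (hs.prod (Set.singleton_nonempty _))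
        (hd.prod (directedOn_singleton _)) (ha.prod hs (Set.singleton_nonempty _) isLUB_singleton)
        ⟨hk, le_rfl⟩
      exact ⟨x.1, hx.1, hkx.1⟩
    · intro s a hs hd ha hk
      obtain ⟨x, hx, hkx⟩ := h ({k.1} ×ˢ s) (k.1, a) ((Set.singleton_nonempty _).prod hs)
        ((directedOn_singleton _).prod hd) (isLUB_singleton.prod (Set.singleton_nonempty _) hs ha)
        ⟨le_rfl, hk⟩
      exact ⟨x.2, hx.2, hkx.2⟩
  · rintro ⟨h1, h2⟩ s a hs hd ha hk
    obtain ⟨_, ⟨x, hx, rfl⟩, hkx⟩ := h1 _ _ (hs.image _) hd.fst (isLUB_prod.1 ha).1 hk.1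
    obtain ⟨_, ⟨y, hy, rfl⟩, hky⟩ := h2 _ _ (hs.image _) hd.snd (isLUB_prod.1 ha).2 hk.2
    obtain ⟨z, hz, hxz, hyz⟩ := hd x hx y hy
    exact ⟨z, hz, hkx.trans hxz.1, hky.trans hyz.2⟩

theorem setOf_compact_prod {D E : Type u} [PartialOrder D] [PartialOrder E] (x : D × E) :
    {k : D × E | IsCompactElement k ∧ k ≤ x} =
      {k : D | IsCompactElement k ∧ k ≤ x.1} ×ˢ {k : E | IsCompactElement k ∧ k ≤ x.2} := by
  ext k
  simp only [Set.mem_prod, Set.mem_ofPred_eq, isCompactElement_prod_iff, Prod.le_def]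
  tauto

theorem isCompactElement_bot {D : Type u} [PartialOrder D] [OrderBot D] :
    IsCompactElement (⊥ : D) := fun _ _ hs _ _ _ => hs.imp fun _ hx => ⟨hx, bot_le⟩

instance isScottDomain_prod {D E : Type u} [PartialOrder D] [OrderBot D] [IsScottDomain D]
    [PartialOrder E] [OrderBot E] [IsScottDomain E] : IsScottDomain (D × E) where
  directedComplete s hs hd := by
    obtain ⟨x, hx⟩ := IsScottDomain.directedComplete _ (hs.image Prod.fst) hd.fst
    obtain ⟨y, hy⟩ := IsScottDomain.directedComplete _ (hs.image Prod.snd) hd.snd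
    exact ⟨(x, y), isLUB_prod.2 ⟨hx, hy⟩⟩
  boundedComplete s hs := by
    obtain ⟨x, hx⟩ := IsScottDomain.boundedComplete _ (monotone_fst.map_bddAbove hs)
    obtain ⟨y, hy⟩ := IsScottDomain.boundedComplete _ (monotone_snd.map_bddAbove hs)
    exact ⟨(x, y), isLUB_prod.2 ⟨hx, hy⟩⟩
  directedOn_compact x := by
    rw [setOf_compact_prod]
    exact (IsScottDomain.directedOn_compact x.1).prod (IsScottDomain.directedOn_compact x.2)
  isLUB_compact x := by
    rw [setOf_compact_prod]
    exact (IsScottDomain.isLUB_compact x.1).prod ⟨⊥, isCompactElement_bot, bot_le⟩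
      ⟨⊥, isCompactElement_bot, bot_le⟩ (IsScottDomain.isLUB_compact x.2)
  countable_compact :=
    (IsScottDomain.countable_compact.prod IsScottDomain.countable_compact).mono
      fun k hk => (isCompactElement_prod_iff k).1 hk

theorem isGLB_pair_prod {D E : Type u} [PartialOrder D] [PartialOrder E] {x y z : D × E} :
    IsGLB {x, y} z ↔ IsGLB {x.1, y.1} z.1 ∧ IsGLB {x.2, y.2} z.2 := by
  rw [isGLB_prod, Set.image_pair, Set.image_pair]

/-- The product of two Scott domains, ordered componentwise. -/
def prod (D E : ScottDom.{u}) : ScottDom.{u} := ⟨D × E⟩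

/-- First projection. -/
def fst (D E : ScottDom.{u}) : prod D E ⟶ D where
  toFun x := x.1
  strict := rfl
  continuous := ScottContinuous.fst (α := D) (β := E)
  map_meet _ _ _ h := (isGLB_pair_prod.1 h).1

/-- Second projection. -/
def snd (D E : ScottDom.{u}) : prod D E ⟶ E where
  toFun x := x.2
  strict := rfl
  continuous := ScottContinuous.snd (α := D) (β := E)
  map_meet _ _ _ h := (isGLB_pair_prod.1 h).2

/-- The pairing `⟨f, g⟩`. -/
def lift {C D E : ScottDom.{u}} (f : C ⟶ D) (g : C ⟶ E) : C ⟶ prod D E where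
  toFun x := (f.toFun x, g.toFun x)
  strict := Prod.ext f.strict g.strict
  continuous := f.continuous.prodMk g.continuous
  map_meet x y z h := isGLB_pair_prod.2 ⟨f.map_meet x y z h, g.map_meet x y z h⟩

end ScottDom

/-! ## Session types -/

/-- Recursive session types in the context of `n` type variables, up to renaming of bound
variables (de Bruijn indices): `var i` is the rule CVar, `mu A` is `ρα.A`, where `α` is the variable
with index `0` of `A`, and the variables of the context of `mu A` are shifted by one in `A`. -/
inductive SessionType : ℕ → Type
  | var {n : ℕ} (i : Fin n) : SessionType n
  | mu {n : ℕ} (A : SessionType (n + 1)) : SessionType n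

namespace SessionType

/-- Renaming of free variables. -/
def rename : {n m : ℕ} → SessionType n → (Fin n → Fin m) → SessionType m
  | _, _, var i, r => var (r i)
  | _, _, mu A, r => mu (A.rename (Fin.cases 0 fun i => (r i).succ))

/-- The capture-avoiding simultaneous substitution `[B_1, …, B_n / α_1, …, α_n] A`. -/
def subst : {n m : ℕ} → SessionType n → (Fin n → SessionType m) → SessionType m
  | _, _, var i, B => B i
  | _, _, mu A, B => mu (A.subst (Fin.cases (var 0) fun i => (B i).rename Fin.succ))

end SessionType

/-! ## Interpretations -/

section Interpretation

/-- The interpretation of a context of `n` type variables: the power `M^n`. -/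
abbrev Ctx (n : ℕ) : Type (u + 1) := Fin n → ScottDom.{u}

variable {C : Type u₁} [Category.{v₁} C]

/-- The product `F × G : C ⟶ M` of two functors to `M`. -/
def prodFunctor (F G : C ⥤ ScottDom.{u}) : C ⥤ ScottDom.{u} where
  obj X := ScottDom.prod (F.obj X) (G.obj X)
  map f := ScottDom.lift (ScottDom.fst _ _ ≫ F.map f) (ScottDom.snd _ _ ≫ G.map f)
  map_id X := ScottDom.hom_ext fun x => by
    rw [F.map_id, G.map_id]; rfl
  map_comp f g := ScottDom.hom_ext fun x => by
    rw [F.map_comp, G.map_comp]; rfl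

/-- `π_1 : F × G ⟶ F` -/
def prodFst (F G : C ⥤ ScottDom.{u}) : prodFunctor F G ⟶ F where
  app _ := ScottDom.fst _ _
  naturality _ _ _ := rfl

/-- `π_2 : F × G ⟶ G` -/
def prodSnd (F G : C ⥤ ScottDom.{u}) : prodFunctor F G ⟶ G where
  app _ := ScottDom.snd _ _
  naturality _ _ _ := rfl

/-- The pairing `⟨η, θ⟩ : H ⟶ F × G` of natural transformations. -/
def prodLift {F G H : C ⥤ ScottDom.{u}} (η : H ⟶ F) (θ : H ⟶ G) : H ⟶ prodFunctor F G where
  app X := ScottDom.lift (η.app X) (θ.app X)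
  naturality _ _ f := ScottDom.hom_ext fun x =>
    Prod.ext (congrArg (fun h => h.toFun x) (η.naturality f))
      (congrArg (fun h => h.toFun x) (θ.naturality f))

/-- The tuple of a family of natural transformations. -/
def tupleTrans {n : ℕ} {C : Type u₁} [Category.{v₁} C] [OCategory C]
    {D : Type u₂} [Category.{v₂} D] [OCategory D] {F G : Fin n → LCFunctor C D}
    (η : ∀ i, (F i).toFunctor ⟶ (G i).toFunctor) :
    (LCFunctor.tuple F).toFunctor ⟶ (LCFunctor.tuple G).toFunctor :=
  NatTrans.pi' η

/-- What a session type in the context of `n` variables denotes: locally continuous functors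
`⟦A⟧`, `⟦A⟧^-`, `⟦A⟧^+` from `M^n` to `M` and a 2-cell `⟦A⟧ ⟶ ⟦A⟧^- × ⟦A⟧^+`. -/
structure Interp (n : ℕ) where
  bi : LCFunctor (Ctx.{u} n) ScottDom.{u}
  neg : LCFunctor (Ctx.{u} n) ScottDom.{u}
  pos : LCFunctor (Ctx.{u} n) ScottDom.{u}
  cell : bi.toFunctor ⟶ prodFunctor neg.toFunctor pos.toFunctor

/-- The component `π_1 ∘ cell : ⟦A⟧ ⟶ ⟦A⟧^-`. -/
def Interp.cellNeg {n : ℕ} (I : Interp.{u} n) : I.bi.toFunctor ⟶ I.neg.toFunctor :=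
  I.cell ≫ prodFst _ _

/-- The component `π_2 ∘ cell : ⟦A⟧ ⟶ ⟦A⟧^+`. -/
def Interp.cellPos {n : ℕ} (I : Interp.{u} n) : I.bi.toFunctor ⟶ I.pos.toFunctor :=
  I.cell ≫ prodSnd _ _

variable (c : FixChoice ScottDom.{u})

/-- `F†` for `F : M^(n+1) ⟶ M`, viewed as a functor `M^n × M ⟶ M`; the fixed point is taken in the
variable with index `0`. -/
noncomputable def daggerCtx {n : ℕ} (F : LCFunctor (Ctx.{u} (n + 1)) ScottDom.{u}) :
    LCFunctor (Ctx.{u} n) ScottDom.{u} :=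
  dagger c ((LCFunctor.extend ScottDom.{u} n).comp F)

/-- `η†` for a natural transformation `η` of functors `M^(n+1) ⟶ M`. -/
noncomputable def daggerCtxMap {n : ℕ} {F G : LCFunctor (Ctx.{u} (n + 1)) ScottDom.{u}}
    (η : F.toFunctor ⟶ G.toFunctor) : (daggerCtx c F).toFunctor ⟶ (daggerCtx c G).toFunctor :=
  daggerMap c (F := (LCFunctor.extend ScottDom.{u} n).comp F)
    (G := (LCFunctor.extend ScottDom.{u} n).comp G)
    (Functor.whiskerLeft (LCFunctor.extend ScottDom.{u} n).toFunctor η)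

/-- The interpretation of session types, by induction on their derivation. -/
noncomputable def interp : {n : ℕ} → SessionType n → Interp.{u} n
  | _, .var i =>
    { bi := LCFunctor.eval i
      neg := LCFunctor.eval i
      pos := LCFunctor.eval i
      cell := prodLift (𝟙 _) (𝟙 _) }
  | _, .mu A =>
    { bi := daggerCtx c (interp A).bi
      neg := daggerCtx c (interp A).neg
      pos := daggerCtx c (interp A).pos
      cell := prodLift (daggerCtxMap c (interp A).cellNeg) (daggerCtxMap c (interp A).cellPos) }

end Interpretation

end SessionSem

open SessionSem

/-!
Both polarities of the semantics satisfy the same recursion, so it is enough to study the single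
2-cell `denote c A`, built from identities by tupling, horizontal composition and `†`.

*Canonical fixed points.* The O-colimit of a chain of embeddings is the limit of its projections.
The compact elements of this limit are exactly the images of the compact elements of the stages, and
so it inherits from the stages every property of a Scott domain.

*Embeddings.* If every component of `η` is an embedding, then `FIX η` is the supremum of
`γ_n ∘ η^(n) ∘ φ_n^p`. The reversed morphisms `φ_n ∘ (η^(n))^p ∘ γ_n^p` are ascending too, and by
continuity of composition their supremum is the projection of `FIX η`. The pairing of embeddings
`f` and `g` is an embedding with projection `(x, y) ↦ f^p x ⊓ g^p y`, which is a morphism because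
binary meets are continuous on algebraic domains.

*Substitution.* The functor `F†` depends on its parameter only through `F(D, -)`, so that
reparametrizing along a functor or a 2-cell commutes with `†` up to equality. Substitution then
follows by induction on the type, first for renamings, which `subst` inserts under a binder.
-/

namespace SessionSem

/-! ## Embedding-projection pairs -/

section EPPairs

variable {K : Type u} [Category.{v} K] [OCategory K] {X Y Z : K}

namespace IsEPPair

theorem proj_eq {e e' : X ⟶ Y} {p p' : Y ⟶ X} (h : IsEPPair e p) (h' : IsEPPair e' p')
    (he : e = e') : p = p' := by
  subst he
  exact h.unique h'

theorem emb_comp_proj_comp {e : X ⟶ Y} {p : Y ⟶ X} (h : IsEPPair e p) (g : X ⟶ Z) :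
    e ≫ p ≫ g = g := by
  rw [← Category.assoc, h.comp_eq, Category.id_comp]

theorem proj_comp_emb_comp_le {e : X ⟶ Y} {p : Y ⟶ X} (h : IsEPPair e p) (g : Y ⟶ Z) :
    p ≫ e ≫ g ≤ g := by
  rw [← Category.assoc]
  exact (comp_mono h.comp_le le_rfl).trans_eq (Category.id_comp g)

end IsEPPair

variable {ι : Type*} [Preorder ι] [IsDirectedOrder ι] [Nonempty ι]

theorem isLUB_range_comp {f : ι → (X ⟶ Y)} {g : ι → (Y ⟶ Z)} {a : X ⟶ Y} {b : Y ⟶ Z}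
    (hf : Monotone f) (hg : Monotone g) (ha : IsLUB (Set.range f) a) (hb : IsLUB (Set.range g) b) :
    IsLUB (Set.range fun i => f i ≫ g i) (a ≫ b) := by
  have hab : IsLUB (Set.range fun i => (f i, g i)) (a, b) :=
    isLUB_prod.2 ⟨by rwa [← Set.range_comp], by rwa [← Set.range_comp]⟩
  have h := OCategory.comp_continuous X Y Z (Set.range_nonempty _)
    (hf.prodMk hg).directed_le.directedOn_range hab
  rwa [← Set.range_comp] at h

theorem IsEPPair.of_isLUB {e : ι → (X ⟶ Y)} {p : ι → (Y ⟶ X)} {a : X ⟶ Y} {b : Y ⟶ X}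
    (he : Monotone e) (hp : Monotone p) (ha : IsLUB (Set.range e) a) (hb : IsLUB (Set.range p) b)
    (hid : IsLUB (Set.range fun i => e i ≫ p i) (𝟙 X)) (hle : ∀ i, p i ≫ e i ≤ 𝟙 Y) :
    IsEPPair a b where
  comp_eq := (isLUB_range_comp he hp ha hb).unique hid
  comp_le := (isLUB_range_comp hp he hb ha).2 (Set.forall_mem_range.2 hle)

end EPPairs

namespace EmbChain

variable {K : Type u} [Category.{v} K] [OCategory K] (J : EmbChain K)

/-- The embedding `D_m ⟶ D_n`, for `m ≤ n`, of a chain `D` of embeddings. -/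
def emb {m n : ℕ} (h : m ≤ n) : J.functor.obj m ⟶ J.functor.obj n :=
  J.functor.map (homOfLE h)

/-- The projection `D_n ⟶ D_m`, for `m ≤ n`, of a chain `D` of embeddings. -/
noncomputable def prj {m n : ℕ} (h : m ≤ n) : J.functor.obj n ⟶ J.functor.obj m :=
  (J.isEmbedding (homOfLE h)).proj

theorem isEPPair {m n : ℕ} (h : m ≤ n) : IsEPPair (J.emb h) (J.prj h) :=
  (J.isEmbedding (homOfLE h)).isEPPair

theorem emb_comp {l m n : ℕ} (h : l ≤ m) (h' : m ≤ n) :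
    J.emb h ≫ J.emb h' = J.emb (h.trans h') :=
  (J.functor.map_comp (homOfLE h) (homOfLE h')).symm

theorem prj_comp {l m n : ℕ} (h : l ≤ m) (h' : m ≤ n) :
    J.prj h' ≫ J.prj h = J.prj (h.trans h') :=
  ((J.isEPPair h).comp (J.isEPPair h')).proj_eq (J.isEPPair _) (J.emb_comp h h')

/-- The morphism `D_n ⟶ D_m` of a chain `D` of embeddings, for arbitrary `n` and `m`: the
embedding into a later object, followed by the projection. By `transit_eq` the choice of the later
object does not matter. -/
noncomputable def transit (n m : ℕ) : J.functor.obj n ⟶ J.functor.obj m :=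
  J.emb (le_max_left n m) ≫ J.prj (le_max_right n m)

theorem transit_eq {n m k : ℕ} (hn : n ≤ k) (hm : m ≤ k) :
    J.transit n m = J.emb hn ≫ J.prj hm := by
  have h : max n m ≤ k := max_le hn hm
  rw [transit, ← J.emb_comp (le_max_left n m) h, ← J.prj_comp (le_max_right n m) h,
    Category.assoc, (J.isEPPair h).emb_comp_proj_comp]

theorem transit_self (n : ℕ) : J.transit n n = 𝟙 _ := by
  rw [J.transit_eq le_rfl le_rfl, (J.isEPPair _).comp_eq]

theorem transit_prj (n : ℕ) {m m' : ℕ} (h : m ≤ m') :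
    J.transit n m' ≫ J.prj h = J.transit n m := by
  rw [J.transit_eq (le_max_left n m') (le_max_right n m'),
    J.transit_eq (le_max_left n m') (h.trans (le_max_right n m')), Category.assoc, prj_comp]

theorem emb_transit {n n' : ℕ} (h : n ≤ n') (m : ℕ) :
    J.emb h ≫ J.transit n' m = J.transit n m := by
  rw [J.transit_eq (le_max_left n' m) (le_max_right n' m),
    J.transit_eq (h.trans (le_max_left n' m)) (le_max_right n' m), ← Category.assoc, emb_comp]

theorem prj_transit_le {n m k : ℕ} (hn : n ≤ k) (hm : m ≤ k) :
    J.prj hn ≫ J.transit n m ≤ J.prj hm := by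
  rw [J.transit_eq hn hm]
  exact (J.isEPPair hn).proj_comp_emb_comp_le _

end EmbChain

/-- The O-colimit on a cocone whose legs are embeddings with given projections; that the
compositions `κ_n ∘ κ_n^p` are ascending is automatic. -/
def OColimit.ofIsEPPair {K : Type u} [Category.{v} K] [OCategory K] {J : EmbChain K}
    (s : Limits.Cocone J.functor) (π : ∀ n, s.pt ⟶ J.functor.obj n)
    (h : ∀ n, IsEPPair (s.ι.app n) (π n))
    (hlub : IsLUB (Set.range fun n => π n ≫ s.ι.app n) (𝟙 s.pt)) : OColimit J :=
  have he : ∀ n, IsEmbedding (s.ι.app n) := fun n => ⟨π n, h n⟩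
  have hproj : ∀ n, (he n).proj = π n := fun n => (he n).isEPPair.unique (h n)
  { cocone := s
    isEmbedding := he
    ascending := fun m n hmn => by
      have hπ : π n ≫ J.prj hmn = π m :=
        ((J.isEPPair hmn).comp (h n)).proj_eq (h m) (s.w (homOfLE hmn))
      have hκ : J.emb hmn ≫ s.ι.app n = s.ι.app m := s.w (homOfLE hmn)
      simp only [hproj]
      rw [← hπ, ← hκ, Category.assoc]
      exact comp_mono le_rfl ((J.isEPPair hmn).proj_comp_emb_comp_le _)
    isLUB := by simpa only [hproj] using hlub }

/-! ## Bilimits of posets -/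

section Bilimits

open Set

theorem isCompactElement_lowerAdjoint {α β : Type*} [PartialOrder α] [PartialOrder β] {l : α → β}
    {u : β → α} (gc : GaloisConnection l u) (hu : ScottContinuous u) {k : α}
    (hk : IsCompactElement k) : IsCompactElement (l k) := by
  intro s b hs hd hb hkb
  obtain ⟨_, ⟨y, hy, rfl⟩, hky⟩ := hk _ _ (hs.image u)
    (hd.mono_comp fun {_ _} h => gc.monotone_u h) (hu hs hd hb) (gc.le_u hkb)
  exact ⟨y, hy, gc.l_le hky⟩

theorem isCompactElement_of_lowerAdjoint {α β : Type*} [PartialOrder α] [PartialOrder β]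
    {l : α → β} {u : β → α} (gc : GaloisConnection l u) (hul : Function.LeftInverse u l) {k : α}
    (hk : IsCompactElement (l k)) : IsCompactElement k := by
  intro s a hs hd ha hka
  obtain ⟨_, ⟨x, hx, rfl⟩, hkx⟩ := hk _ _ (hs.image l)
    (hd.mono_comp fun {_ _} h => gc.monotone_l h) (gc.isLUB_l_image ha) (gc.monotone_l hka)
  exact ⟨x, hx, (gc.le_u hkx).trans_eq (hul x)⟩

variable {ι P : Type*} [Preorder ι] [PartialOrder P] {D : ι → Type*} [∀ i, PartialOrder (D i)]

/-- The poset `P` is the bilimit of the posets `D i`, with embeddings `κ i` and projections `π i`: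
each element of `P` is the ascending supremum of its images under the idempotents `κ i ∘ π i`. The
connecting maps between the `D i` are not part of the data. -/
structure IsBilimit (κ : ∀ i, D i → P) (π : ∀ i, P → D i) : Prop where
  gc : ∀ i, GaloisConnection (κ i) (π i)
  leftInverse : ∀ i, Function.LeftInverse (π i) (κ i)
  scottContinuous : ∀ i, ScottContinuous (π i)
  monotone : ∀ x, Monotone fun i => κ i (π i x)
  isLUB : ∀ x, IsLUB (range fun i => κ i (π i x)) x

namespace IsBilimit

variable {κ : ∀ i, D i → P} {π : ∀ i, P → D i} (h : IsBilimit κ π)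

include h

theorem isCompactElement_iff {i : ι} {k : D i} :
    IsCompactElement (κ i k) ↔ IsCompactElement k :=
  ⟨isCompactElement_of_lowerAdjoint (h.gc i) (h.leftInverse i),
    isCompactElement_lowerAdjoint (h.gc i) (h.scottContinuous i)⟩

theorem isLUB_compact (hD : ∀ i (x : D i), IsLUB {k | IsCompactElement k ∧ k ≤ x} x) (x : P) :
    IsLUB {k | IsCompactElement k ∧ k ≤ x} x := by
  refine ⟨fun k hk => hk.2, fun b hb => (h.isLUB x).2 (forall_mem_range.2 fun i => ?_)⟩
  refine (h.gc i).l_le ((hD i (π i x)).2 fun k ⟨hk, hkx⟩ => (h.gc i).le_u ?_)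
  exact hb ⟨h.isCompactElement_iff.2 hk, (h.gc i).l_le hkx⟩

variable [IsDirectedOrder ι] [Nonempty ι]

theorem exists_forall_ge_eq {k : P} (hk : IsCompactElement k) :
    ∃ i, ∀ j, i ≤ j → κ j (π j k) = k := by
  obtain ⟨_, ⟨i, rfl⟩, hi⟩ := hk _ _ (range_nonempty _)
    (h.monotone k).directed_le.directedOn_range (h.isLUB k) le_rfl
  exact ⟨i, fun j hij => ((h.gc j).l_u_le k).antisymm (hi.trans (h.monotone k hij))⟩

theorem exists_compact_eq {k : P} (hk : IsCompactElement k) :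
    ∃ i, ∀ j, i ≤ j → ∃ a : D j, IsCompactElement a ∧ κ j a = k := by
  obtain ⟨i, hi⟩ := h.exists_forall_ge_eq hk
  refine ⟨i, fun j hij => ⟨π j k, h.isCompactElement_iff.1 ?_, hi j hij⟩⟩
  rwa [hi j hij]

theorem directedOn_compact
    (hD : ∀ i (x : D i), DirectedOn (· ≤ ·) {k | IsCompactElement k ∧ k ≤ x}) (x : P) :
    DirectedOn (· ≤ ·) {k | IsCompactElement k ∧ k ≤ x} := by
  rintro k ⟨hk, hkx⟩ l ⟨hl, hlx⟩
  obtain ⟨i, hi⟩ := h.exists_compact_eq hk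
  obtain ⟨j, hj⟩ := h.exists_compact_eq hl
  obtain ⟨n, hin, hjn⟩ := exists_ge_ge i j
  obtain ⟨a, ha, rfl⟩ := hi n hin
  obtain ⟨b, hb, rfl⟩ := hj n hjn
  obtain ⟨d, ⟨hd, hdx⟩, had, hbd⟩ :=
    hD n (π n x) a ⟨ha, (h.gc n).le_u hkx⟩ b ⟨hb, (h.gc n).le_u hlx⟩
  exact ⟨κ n d, ⟨h.isCompactElement_iff.2 hd, (h.gc n).l_le hdx⟩, (h.gc n).monotone_l had,
    (h.gc n).monotone_l hbd⟩

theorem countable_compact [Countable ι] (hD : ∀ i, {k : D i | IsCompactElement k}.Countable) :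
    {k : P | IsCompactElement k}.Countable := by
  refine (countable_iUnion fun i => (hD i).image (κ i)).mono fun k hk => ?_
  obtain ⟨i, hi⟩ := h.exists_compact_eq hk
  exact mem_iUnion.2 ⟨i, hi i le_rfl⟩

theorem exists_isLUB_of_bddAbove
    (hP : ∀ s : Set P, s.Nonempty → DirectedOn (· ≤ ·) s → ∃ x, IsLUB s x)
    (hD : ∀ i (s : Set (D i)), BddAbove s → ∃ x, IsLUB s x) {s : Set P} (hs : BddAbove s) :
    ∃ x, IsLUB s x := by
  choose a ha using fun i => hD i (π i '' s) ((h.gc i).monotone_u.map_bddAbove hs)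
  have hκ : ∀ {i b}, κ i (a i) ≤ b ↔ ∀ x ∈ s, κ i (π i x) ≤ b := fun {i b} => by
    rw [isLUB_le_iff ((h.gc i).isLUB_l_image (ha i)), mem_upperBounds, forall_mem_image,
      forall_mem_image]
  have hmono : Monotone fun i => κ i (a i) := fun i j hij =>
    hκ.2 fun x hx => (h.monotone x hij).trans (hκ.1 le_rfl x hx)
  obtain ⟨z, hz⟩ := hP _ (range_nonempty _) hmono.directed_le.directedOn_range
  refine ⟨z, fun x hx => (h.isLUB x).2 (forall_mem_range.2 fun i => ?_),
    fun b hb => hz.2 (forall_mem_range.2 fun i => ?_)⟩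
  · exact (hκ.1 le_rfl x hx).trans (hz.1 ⟨i, rfl⟩)
  · exact hκ.2 fun x hx => ((h.gc i).l_u_le x).trans (hb hx)

theorem isScottDomain [Countable ι] [OrderBot P] [∀ i, OrderBot (D i)] [∀ i, IsScottDomain (D i)]
    (hP : ∀ s : Set P, s.Nonempty → DirectedOn (· ≤ ·) s → ∃ x, IsLUB s x) : IsScottDomain P where
  directedComplete := hP
  boundedComplete _ := h.exists_isLUB_of_bddAbove hP fun _ => IsScottDomain.boundedComplete
  directedOn_compact := h.directedOn_compact fun _ => IsScottDomain.directedOn_compact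
  isLUB_compact := h.isLUB_compact fun _ => IsScottDomain.isLUB_compact
  countable_compact := h.countable_compact fun _ => IsScottDomain.countable_compact

end IsBilimit

end Bilimits

/-! ## O-colimits of Scott domains -/

theorem scottContinuous_inf {α : Type*} [SemilatticeInf α]
    (hα : ∀ x : α, IsLUB {k | IsCompactElement k ∧ k ≤ x} x) :
    ScottContinuous fun x : α × α => x.1 ⊓ x.2 := by
  intro s hs hd a ha
  have hmono : Monotone fun x : α × α => x.1 ⊓ x.2 := fun _ _ h => inf_le_inf h.1 h.2
  refine ⟨hmono.mem_upperBounds_image ha.1, fun b hb => (hα _).2 fun k ⟨hk, hka⟩ => ?_⟩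
  obtain ⟨ha₁, ha₂⟩ := isLUB_prod.1 ha
  obtain ⟨_, ⟨x, hx, rfl⟩, hkx⟩ := hk _ _ (hs.image _) hd.fst ha₁ (hka.trans inf_le_left)
  obtain ⟨_, ⟨y, hy, rfl⟩, hky⟩ := hk _ _ (hs.image _) hd.snd ha₂ (hka.trans inf_le_right)
  obtain ⟨z, hz, hxz, hyz⟩ := hd x hx y hy
  exact (le_inf (hkx.trans hxz.1) (hky.trans hyz.2)).trans (hb ⟨z, hz, rfl⟩)

namespace ScottDom

section Meets

theorem exists_isGLB_pair (D : ScottDom.{u}) (x y : D) : ∃ z, IsGLB {x, y} z := by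
  obtain ⟨z, hz⟩ := IsScottDomain.boundedComplete (lowerBounds {x, y})
    ⟨x, fun w hw => hw (Set.mem_insert x _)⟩
  exact ⟨z, isLUB_lowerBounds.1 hz⟩

noncomputable instance (D : ScottDom.{u}) : SemilatticeInf D :=
  SemilatticeInf.ofIsGLB (fun x y => (exists_isGLB_pair D x y).choose)
    fun x y => (exists_isGLB_pair D x y).choose_spec

theorem Hom.map_inf {D E : ScottDom.{u}} (f : D ⟶ E) (x y : D) :
    f.toFun (x ⊓ y) = f.toFun x ⊓ f.toFun y :=
  (f.map_meet x y _ isGLB_pair).unique isGLB_pair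

/-- The binary meet of a Scott domain, as a morphism. -/
noncomputable def meet (D : ScottDom.{u}) : prod D D ⟶ D where
  toFun x := x.1 ⊓ x.2
  strict := bot_inf_eq ⊥
  continuous := scottContinuous_inf IsScottDomain.isLUB_compact
  map_meet x y z h := by
    obtain ⟨h₁, h₂⟩ := isGLB_pair_prod.1 h
    rw [h₁.unique isGLB_pair, h₂.unique isGLB_pair, inf_inf_inf_comm]
    exact isGLB_pair

theorem isEPPair_lift {C D E : ScottDom.{u}} {f : C ⟶ D} {g : C ⟶ E} {p : D ⟶ C} {q : E ⟶ C}
    (hp : IsEPPair f p) (hq : IsEPPair g q) :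
    IsEPPair (lift f g) (lift (fst D E ≫ p) (snd D E ≫ q) ≫ meet C) where
  comp_eq := hom_ext fun x => by
    have hpf : p.toFun (f.toFun x) = x := congrArg (fun h => h.toFun x) hp.comp_eq
    have hqg : q.toFun (g.toFun x) = x := congrArg (fun h => h.toFun x) hq.comp_eq
    change p.toFun (f.toFun x) ⊓ q.toFun (g.toFun x) = x
    rw [hpf, hqg, inf_idem]
  comp_le x :=
    ⟨(f.continuous.monotone inf_le_left).trans (hp.comp_le x.1),
      (g.continuous.monotone inf_le_right).trans (hq.comp_le x.2)⟩

end Meets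

variable (J : EmbChain ScottDom.{u})

/-- The limit of the projections of a chain `D` of embeddings: the sequences `x` with
`x_n ∈ D_n` that are compatible with the projections. It carries the O-colimit of the chain. -/
def LimitSeq : Type u :=
  {x : ∀ n, J.functor.obj n // ∀ {m n : ℕ} (h : m ≤ n), (J.prj h).toFun (x n) = x m}

namespace LimitSeq

instance : PartialOrder (LimitSeq J) :=
  inferInstanceAs (PartialOrder
    {x : ∀ n, J.functor.obj n // ∀ {m n : ℕ} (h : m ≤ n), (J.prj h).toFun (x n) = x m})

instance : OrderBot (LimitSeq J) where
  bot := ⟨fun _ => ⊥, fun h => (J.prj h).strict⟩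
  bot_le _ := fun _ => bot_le

variable {J}

theorem isLUB_of_forall {s : Set (LimitSeq J)} {a : LimitSeq J}
    (h : ∀ n, IsLUB ((fun x : LimitSeq J => x.1 n) '' s) (a.1 n)) : IsLUB s a :=
  IsLUB.of_image (f := fun x : LimitSeq J => x.1) Iff.rfl
    (isLUB_pi.2 fun n => by rw [Set.image_image]; exact h n)

theorem isGLB_pair_of_forall {x y z : LimitSeq J} (h : ∀ n, IsGLB {x.1 n, y.1 n} (z.1 n)) :
    IsGLB {x, y} z :=
  IsGLB.of_image (f := fun x : LimitSeq J => x.1) Iff.rfl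
    (isGLB_pi.2 fun n => by rw [Set.image_image, Set.image_pair]; exact h n)

theorem isGLB_pair_apply {x y z : LimitSeq J} (h : IsGLB {x, y} z) (n : ℕ) :
    IsGLB {x.1 n, y.1 n} (z.1 n) := by
  let w : LimitSeq J := ⟨fun n => x.1 n ⊓ y.1 n, fun h => by rw [Hom.map_inf, x.2, y.2]⟩
  have hzw : z = w := h.unique (isGLB_pair_of_forall fun n => isGLB_pair)
  rw [hzw]
  exact isGLB_pair

theorem exists_forall_isLUB (s : Set (LimitSeq J)) (hs : s.Nonempty)
    (hd : DirectedOn (· ≤ ·) s) :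
    ∃ a : LimitSeq J, ∀ n, IsLUB ((fun x : LimitSeq J => x.1 n) '' s) (a.1 n) := by
  have hdir : ∀ n, DirectedOn (· ≤ ·) ((fun x : LimitSeq J => x.1 n) '' s) := fun n =>
    hd.mono_comp fun {_ _} h => h n
  choose a ha using fun n => IsScottDomain.directedComplete _ (hs.image _) (hdir n)
  refine ⟨⟨a, fun {m n} h => ?_⟩, ha⟩
  refine ((J.prj h).continuous (hs.image _) (hdir n) (ha n)).unique ?_
  rw [Set.image_image, Set.image_congr fun x _ => x.2 h]
  exact ha m

theorem scottContinuous_apply (n : ℕ) : ScottContinuous fun x : LimitSeq J => x.1 n := by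
  intro s hs hd a ha
  obtain ⟨b, hb⟩ := exists_forall_isLUB s hs hd
  rw [ha.unique (isLUB_of_forall hb)]
  exact hb n

variable (J) in
/-- The embedding of `D_n` into the limit of a chain `D` of embeddings. -/
noncomputable def leg (n : ℕ) (x : J.functor.obj n) : LimitSeq J :=
  ⟨fun m => (J.transit n m).toFun x, fun h =>
    congrArg (fun f => f.toFun x) (J.transit_prj n h)⟩

theorem leg_apply_self (n : ℕ) (x : J.functor.obj n) : (leg J n x).1 n = x :=
  congrArg (fun f => f.toFun x) (J.transit_self n)

theorem leg_emb {m n : ℕ} (h : m ≤ n) (x : J.functor.obj m) :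
    leg J n ((J.emb h).toFun x) = leg J m x :=
  Subtype.ext (funext fun k => congrArg (fun f => f.toFun x) (J.emb_transit h k))

theorem monotone_leg (n : ℕ) : Monotone (leg J n) :=
  fun _ _ h m => (J.transit n m).continuous.monotone h

theorem leg_apply_le (n : ℕ) (x : LimitSeq J) : leg J n (x.1 n) ≤ x := by
  intro m
  change (J.transit n m).toFun (x.1 n) ≤ x.1 m
  rw [← x.2 (le_max_left n m), ← x.2 (le_max_right n m)]
  exact J.prj_transit_le (le_max_left n m) (le_max_right n m) (x.1 (max n m))

theorem monotone_leg_apply (x : LimitSeq J) : Monotone fun n => leg J n (x.1 n) := by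
  intro m n h
  change leg J m (x.1 m) ≤ leg J n (x.1 n)
  rw [← leg_emb h, ← x.2 h]
  exact monotone_leg n ((J.isEPPair h).comp_le (x.1 n))

theorem isLUB_leg_apply (x : LimitSeq J) : IsLUB (Set.range fun n => leg J n (x.1 n)) x := by
  refine ⟨Set.forall_mem_range.2 fun n => leg_apply_le n x, fun b hb m => ?_⟩
  calc x.1 m = (leg J m (x.1 m)).1 m := (leg_apply_self m _).symm
    _ ≤ b.1 m := hb ⟨m, rfl⟩ m

theorem isBilimit_leg : IsBilimit (leg J) fun n x => x.1 n where
  gc n a x :=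
    ⟨fun h => (leg_apply_self n a).ge.trans (h n),
      fun h => (monotone_leg n h).trans (leg_apply_le n x)⟩
  leftInverse := leg_apply_self
  scottContinuous := scottContinuous_apply
  monotone := monotone_leg_apply
  isLUB := isLUB_leg_apply

instance : IsScottDomain (LimitSeq J) :=
  isBilimit_leg.isScottDomain fun s hs hd =>
    (exists_forall_isLUB s hs hd).imp fun _ => isLUB_of_forall

variable (J)

/-- The cocone of embeddings of a chain into its limit. -/
noncomputable def cocone : Limits.Cocone J.functor where
  pt := ⟨LimitSeq J⟩
  ι :=
    { app n :=
        { toFun := leg J n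
          strict := Subtype.ext (funext fun m => (J.transit n m).strict)
          continuous := fun _ _ _ _ h => (isBilimit_leg.gc n).isLUB_l_image h
          map_meet := fun x y z h =>
            isGLB_pair_of_forall fun m => (J.transit n m).map_meet x y z h }
      naturality _ _ f := hom_ext (leg_emb (leOfHom f)) }

/-- The projections of the limit of a chain of embeddings onto the objects of the chain. -/
def proj (n : ℕ) : (cocone J).pt ⟶ J.functor.obj n where
  toFun x := x.1 n
  strict := rfl
  continuous := scottContinuous_apply n
  map_meet _ _ _ h := isGLB_pair_apply h n

/-- The limit of the projections of a chain of embeddings, as an O-colimit of the chain. -/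
noncomputable def oColimit : OColimit J :=
  OColimit.ofIsEPPair (cocone J) (proj J)
    (fun n => ⟨hom_ext (leg_apply_self n), leg_apply_le n⟩)
    ⟨Set.forall_mem_range.2 leg_apply_le, fun _ hb x =>
      (isLUB_leg_apply x).2 (Set.forall_mem_range.2 fun n => hb ⟨n, rfl⟩ x)⟩

end LimitSeq

instance : IsScottDomain PUnit.{u + 1} where
  directedComplete _ _ _ := ⟨⟨⟩, fun _ _ => le_rfl, fun _ _ => le_rfl⟩
  boundedComplete _ _ := ⟨⟨⟩, fun _ _ => le_rfl, fun _ _ => le_rfl⟩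
  directedOn_compact _ := fun x hx _ _ => ⟨x, hx, le_rfl, le_rfl⟩
  isLUB_compact _ := ⟨fun _ _ => le_rfl, fun _ _ => le_rfl⟩
  countable_compact := Set.to_countable _

theorem hasInitial : Limits.HasInitial ScottDom.{u} :=
  (Limits.IsInitial.ofUniqueHom (X := (⟨PUnit.{u + 1}⟩ : ScottDom.{u})) (fun _ => 0)
    fun _ f => hom_ext fun _ => f.strict).hasInitial

theorem supportsCanonicalFixedPoints : SupportsCanonicalFixedPoints ScottDom.{u} where
  hasInitial := hasInitial
  strict := inferInstance
  ocomplete J := ⟨LimitSeq.oColimit J⟩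

end ScottDom

/-! ## Embeddings between canonical fixed points -/

section FixEmbedding

variable {E : Type u} [Category.{v} E] [OCategory E]

theorem isEmbedding_iterTrans {F G : LCFunctor E E} {η : F.toFunctor ⟶ G.toFunctor}
    (h : ∀ X, IsEmbedding (η.app X)) (X : E) (n : ℕ) : IsEmbedding (iterTrans η X n) := by
  induction n with
  | zero => exact ⟨_, IsEPPair.id X⟩
  | succ n ih => exact IsEmbedding.comp ⟨_, F.map_isEPPair ih.isEPPair⟩ (h _)

variable [Limits.HasZeroMorphisms E] [HasStrictMorphisms E] (c : FixChoice E)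

theorem fixProj_succ_comp_iterLink_proj (F : LCFunctor E E) (n : ℕ) :
    fixProj c F (n + 1) ≫ (isEmbedding_iterLink c F n).proj = fixProj c F n :=
  ((isEmbedding_iterLink c F n).isEPPair.comp (isEPPair_fix c F (n + 1))).proj_eq
    (isEPPair_fix c F n) (iterLink_fixLeg c F n)

variable {F G : LCFunctor E E} {η : F.toFunctor ⟶ G.toFunctor} (h : ∀ X, IsEmbedding (η.app X))

theorem iterTrans_proj_comp_iterLink_proj (n : ℕ) :
    (isEmbedding_iterTrans h c.bot (n + 1)).proj ≫ (isEmbedding_iterLink c F n).proj =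
      (isEmbedding_iterLink c G n).proj ≫ (isEmbedding_iterTrans h c.bot n).proj :=
  ((isEmbedding_iterLink c F n).isEPPair.comp (isEmbedding_iterTrans h c.bot (n + 1)).isEPPair
    ).proj_eq
    ((isEmbedding_iterTrans h c.bot n).isEPPair.comp (isEmbedding_iterLink c G n).isEPPair)
    (iterLink_iterTrans η n)

/-- `φ_n ∘ (η^(n))^p ∘ γ_n^p : FIX G ⟶ FIX F`, where `φ` and `γ` are the chosen O-colimits: the
approximations to the projection of the embedding `FIX η`. -/
noncomputable def fixCoapprox (n : ℕ) : fixObj c G ⟶ fixObj c F :=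
  fixProj c G n ≫ (isEmbedding_iterTrans h c.bot n).proj ≫ fixLeg c F n

theorem monotone_fixCoapprox : Monotone (fixCoapprox c h) := by
  refine monotone_nat_of_le_succ fun n => ?_
  let link := (isEmbedding_iterLink c F n).proj
  calc fixCoapprox c h n
      = fixProj c G (n + 1) ≫ (isEmbedding_iterTrans h c.bot (n + 1)).proj ≫ link ≫
          iterLink F.toFunctor (c.isInitial.to (F.obj c.bot)) n ≫ fixLeg c F (n + 1) := by
        rw [fixCoapprox, ← fixProj_succ_comp_iterLink_proj, iterLink_fixLeg, Category.assoc,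
          ← Category.assoc (isEmbedding_iterLink c G n).proj,
          ← iterTrans_proj_comp_iterLink_proj c h, Category.assoc]
    _ ≤ fixCoapprox c h (n + 1) :=
        comp_mono le_rfl (comp_mono le_rfl
          ((isEmbedding_iterLink c F n).isEPPair.proj_comp_emb_comp_le _))

theorem fixApprox_comp_fixCoapprox (n : ℕ) :
    fixApprox c η n ≫ fixCoapprox c h n = fixProj c F n ≫ fixLeg c F n := by
  simp only [fixApprox, fixCoapprox, Category.assoc, (isEPPair_fix c G n).emb_comp_proj_comp,
    (isEmbedding_iterTrans h c.bot n).isEPPair.emb_comp_proj_comp]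

theorem fixCoapprox_comp_fixApprox_le (n : ℕ) :
    fixCoapprox c h n ≫ fixApprox c η n ≤ 𝟙 (fixObj c G) := by
  simp only [fixApprox, fixCoapprox, Category.assoc, (isEPPair_fix c F n).emb_comp_proj_comp]
  exact (comp_mono le_rfl
    ((isEmbedding_iterTrans h c.bot n).isEPPair.proj_comp_emb_comp_le _)).trans
      (isEPPair_fix c G n).comp_le

include h in
theorem isEmbedding_fixMap : IsEmbedding (fixMap c η) := by
  have hmono := monotone_fixCoapprox c h
  obtain ⟨p, hp⟩ := OCategory.exists_isLUB _ (Set.range_nonempty _)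
    hmono.directed_le.directedOn_range
  refine ⟨p, .of_isLUB (monotone_fixApprox c η) hmono (isLUB_fixMap c η) hp ?_
    (fixCoapprox_comp_fixApprox_le c h)⟩
  simp only [fixApprox_comp_fixCoapprox]
  exact (c.colim (fixChain c F)).isLUB

end FixEmbedding

/-! ## Cells -/

namespace LCFunctor

variable {C : Type u₁} [Category.{v₁} C] [OCategory C]
  {D : Type u₂} [Category.{v₂} D] [OCategory D]
  {E : Type u₃} [Category.{v₃} E] [OCategory E]

theorem ext_toFunctor {F G : LCFunctor C D} (h : F.toFunctor = G.toFunctor) : F = G := by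
  cases F; cases G; cases h; rfl

variable (E) in
/-- The functor `F × E : C × E ⟶ D × E`. -/
def prodRight (F : LCFunctor C D) : LCFunctor (C × E) (D × E) where
  toFunctor := F.toFunctor.prod (𝟭 E)
  scottContinuous_map X Y :=
    ScottContinuous.prodMk (α := (X.1 ⟶ Y.1) × (X.2 ⟶ Y.2))
      (ScottContinuous.fst.comp (F.scottContinuous_map X.1 Y.1)) ScottContinuous.snd

theorem partialApp_prodRight_comp (F : LCFunctor C D) (G : LCFunctor (D × E) E) (X : C) :
    ((F.prodRight E).comp G).partialApp X = G.partialApp (F.obj X) :=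
  ext_toFunctor <| CategoryTheory.Functor.hext (fun _ => rfl) fun Y Z g => heq_of_eq <|
    congrArg (fun f => G.map (X := (F.obj X, Y)) (Y := (F.obj X, Z)) (f, g)) (F.map_id X)

end LCFunctor

section DaggerReparametrization

variable {C : Type u₁} [Category.{v₁} C] [OCategory C]
  {D : Type u₂} [Category.{v₂} D] [OCategory D]
  {E : Type u} [Category.{v} E] [OCategory E]
  [Limits.HasZeroMorphisms E] [HasStrictMorphisms E] (c : FixChoice E)

theorem fixMap_heq {F F' G G' : LCFunctor E E} (hF : F = F') (hG : G = G')
    {η : F.toFunctor ⟶ G.toFunctor} {θ : F'.toFunctor ⟶ G'.toFunctor}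
    (h : ∀ X, η.app X ≍ θ.app X) : fixMap c η ≍ fixMap c θ := by
  subst hF hG
  obtain rfl : η = θ := NatTrans.ext (funext fun X => eq_of_heq (h X))
  rfl

theorem dagger_prodRight_comp (F : LCFunctor C D) (G : LCFunctor (D × E) E) :
    dagger c ((F.prodRight E).comp G) = F.comp (dagger c G) :=
  LCFunctor.ext_toFunctor <| CategoryTheory.Functor.hext
    (fun X => congrArg (fixObj c) (F.partialApp_prodRight_comp G X))
    fun X Y _ => fixMap_heq c (F.partialApp_prodRight_comp G X) (F.partialApp_prodRight_comp G Y)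
      fun _ => HEq.rfl

end DaggerReparametrization

/-- A 2-cell between locally continuous functors, bundled with its source and target: equations
of cells express equations of functors and, along these, of natural transformations. -/
structure Cell (C : Type u₁) [Category.{v₁} C] [OCategory C]
    (D : Type u₂) [Category.{v₂} D] [OCategory D] where
  src : LCFunctor C D
  tgt : LCFunctor C D
  trans : src.toFunctor ⟶ tgt.toFunctor

namespace Cell

section HorizontalComposition

variable {C : Type u₁} [Category.{v₁} C] [OCategory C]
  {D : Type u₂} [Category.{v₂} D] [OCategory D]
  {E : Type u₃} [Category.{v₃} E] [OCategory E]

theorem ext_app {α β : Cell C D} (hs : α.src = β.src) (ht : α.tgt = β.tgt)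
    (h : ∀ X, α.trans.app X ≍ β.trans.app X) : α = β := by
  obtain ⟨F, G, η⟩ := α
  obtain ⟨F', G', θ⟩ := β
  obtain rfl : F = F' := hs
  obtain rfl : G = G' := ht
  obtain rfl : η = θ := NatTrans.ext (funext fun X => eq_of_heq (h X))
  rfl

/-- The identity 2-cell of a functor. -/
def id (F : LCFunctor C D) : Cell C D := ⟨F, F, 𝟙 _⟩

/-- Horizontal composition, in diagrammatic order. -/
def comp (α : Cell C D) (β : Cell D E) : Cell C E :=
  ⟨α.src.comp β.src, α.tgt.comp β.tgt, α.trans ◫ β.trans⟩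

theorem comp_assoc {E' : Type u} [Category.{v} E'] [OCategory E'] (α : Cell C D) (β : Cell D E)
    (γ : Cell E E') : (α.comp β).comp γ = α.comp (β.comp γ) := by
  refine ext_app rfl rfl fun X => heq_of_eq ?_
  change γ.trans.app _ ≫ γ.tgt.map (β.trans.app _ ≫ β.tgt.map (α.trans.app X)) =
    (γ.trans.app _ ≫ γ.tgt.map (β.trans.app _)) ≫ γ.tgt.map (β.tgt.map (α.trans.app X))
  rw [Functor.map_comp, Category.assoc]

theorem id_comp_id (F : LCFunctor C D) (G : LCFunctor D E) :
    (id F).comp (id G) = id (F.comp G) := by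
  refine ext_app rfl rfl fun X => heq_of_eq ?_
  change 𝟙 _ ≫ G.map (𝟙 (F.obj X)) = 𝟙 _
  rw [CategoryTheory.Functor.map_id, Category.comp_id]

theorem id_comp (F : LCFunctor C D) (α : Cell D E) :
    (id F).comp α =
      ⟨F.comp α.src, F.comp α.tgt, Functor.whiskerLeft F.toFunctor α.trans⟩ := by
  refine ext_app rfl rfl fun X => heq_of_eq ?_
  change α.trans.app (F.obj X) ≫ α.tgt.map (𝟙 (F.obj X)) = α.trans.app (F.obj X)
  rw [CategoryTheory.Functor.map_id, Category.comp_id]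

/-- The tuple of a family of 2-cells. -/
def tuple {n : ℕ} (α : Fin n → Cell C D) : Cell C (Fin n → D) :=
  ⟨LCFunctor.tuple fun i => (α i).src, LCFunctor.tuple fun i => (α i).tgt,
    tupleTrans fun i => (α i).trans⟩

theorem tuple_comp_eval {n : ℕ} (α : Fin n → Cell C D) (i : Fin n) :
    (tuple α).comp (id (LCFunctor.eval i)) = α i :=
  ext_app rfl rfl fun X => heq_of_eq (Category.id_comp ((α i).trans.app X))

theorem ext_eval {n : ℕ} {α β : Cell C (Fin n → D)}
    (h : ∀ i, α.comp (id (LCFunctor.eval i)) = β.comp (id (LCFunctor.eval i))) : α = β := by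
  obtain ⟨F, G, η⟩ := α
  obtain ⟨F', G', θ⟩ := β
  obtain rfl : F = F' := LCFunctor.ext_toFunctor <| Functor.pi_ext _ _ fun i =>
    congrArg (fun γ : Cell C D => γ.src.toFunctor) (h i)
  obtain rfl : G = G' := LCFunctor.ext_toFunctor <| Functor.pi_ext _ _ fun i =>
    congrArg (fun γ : Cell C D => γ.tgt.toFunctor) (h i)
  refine ext_app rfl rfl fun X => heq_of_eq (funext fun i => ?_)
  injection h i with _ _ hηθ
  have hX : 𝟙 (F.obj X i) ≫ η.app X i = 𝟙 (F.obj X i) ≫ θ.app X i :=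
    congrArg (fun τ => τ.app X) hηθ
  simpa only [Category.id_comp] using hX

variable (E) in
/-- The 2-cell `α × E`. -/
def prodRight (α : Cell C D) : Cell (C × E) (D × E) :=
  ⟨α.src.prodRight E, α.tgt.prodRight E, NatTrans.prod α.trans (𝟙 (𝟭 E))⟩

theorem prodRight_comp_fst (α : Cell C D) :
    (α.prodRight E).comp (id (LCFunctor.fst D E)) = (id (LCFunctor.fst C E)).comp α := by
  rw [id_comp]
  exact ext_app rfl rfl fun X => heq_of_eq (Category.id_comp (α.trans.app X.1))

theorem prodRight_comp_snd (α : Cell C D) :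
    (α.prodRight E).comp (id (LCFunctor.snd D E)) = id (LCFunctor.snd C E) :=
  ext_app rfl rfl fun X => heq_of_eq (Category.comp_id (𝟙 X.2))

end HorizontalComposition

section Contexts

variable {E : Type u} [Category.{v} E] [OCategory E]

variable (E) in
/-- The projection `E^(n+1) ⟶ E^n` that forgets the component with index `0`: weakening by a
variable. -/
def weaken (n : ℕ) : Cell (Fin (n + 1) → E) (Fin n → E) :=
  tuple fun i => id (LCFunctor.eval i.succ)

theorem extend_comp_eval_zero (n : ℕ) :
    (id (LCFunctor.extend E n)).comp (id (LCFunctor.eval 0)) = id (LCFunctor.snd _ _) :=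
  id_comp_id _ _

theorem extend_comp_eval_succ (n : ℕ) (i : Fin n) :
    (id (LCFunctor.extend E n)).comp (id (LCFunctor.eval i.succ)) =
      (id (LCFunctor.fst _ _)).comp (id (LCFunctor.eval i)) := by
  rw [id_comp_id, id_comp_id]; rfl

theorem extend_comp_weaken (n : ℕ) :
    (id (LCFunctor.extend E n)).comp (weaken E n) = id (LCFunctor.fst _ _) :=
  ext_eval fun i => by
    rw [comp_assoc, weaken, tuple_comp_eval, extend_comp_eval_succ]

theorem extend_comp_tuple {n m : ℕ} {β : Fin n → Cell (Fin m → E) E}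
    {γ : Fin (n + 1) → Cell (Fin (m + 1) → E) E} (hzero : γ 0 = id (LCFunctor.eval 0))
    (hsucc : ∀ i : Fin n, γ i.succ = (weaken E m).comp (β i)) :
    (id (LCFunctor.extend E m)).comp (tuple γ) =
      ((tuple β).prodRight E).comp (id (LCFunctor.extend E n)) :=
  ext_eval fun i => by
    rw [comp_assoc, tuple_comp_eval, comp_assoc]
    refine Fin.cases ?_ (fun i => ?_) i
    · rw [hzero, extend_comp_eval_zero, extend_comp_eval_zero, prodRight_comp_snd]
    · rw [hsucc, extend_comp_eval_succ, ← comp_assoc, extend_comp_weaken, ← comp_assoc,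
        prodRight_comp_fst, comp_assoc, tuple_comp_eval]

end Contexts

section Dagger

variable {C : Type u₁} [Category.{v₁} C] [OCategory C]
  {D : Type u₂} [Category.{v₂} D] [OCategory D]
  {E : Type u} [Category.{v} E] [OCategory E]
  [Limits.HasZeroMorphisms E] [HasStrictMorphisms E] (c : FixChoice E)

/-- The dagger of a 2-cell `F ⟶ G` of functors `D × E ⟶ E`: the 2-cell `F† ⟶ G†`. -/
noncomputable def dagger (α : Cell (D × E) E) : Cell D E :=
  ⟨SessionSem.dagger c α.src, SessionSem.dagger c α.tgt, daggerMap c α.trans⟩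

theorem dagger_prodRight_comp (α : Cell C D) (β : Cell (D × E) E) :
    dagger c ((α.prodRight E).comp β) = α.comp (dagger c β) := by
  refine ext_app (SessionSem.dagger_prodRight_comp c α.src β.src)
    (SessionSem.dagger_prodRight_comp c α.tgt β.tgt) fun X => ?_
  have hcomp : (α.comp (dagger c β)).trans.app X =
      fixMap c (partialTrans β.trans (α.src.obj X) ≫ partialMap β.tgt (α.trans.app X)) :=
    (fixMap_comp c _ _).symm
  rw [hcomp]
  exact fixMap_heq c (α.src.partialApp_prodRight_comp β.src X)
    (α.tgt.partialApp_prodRight_comp β.tgt X) fun _ => HEq.rfl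

/-- The dagger of a 2-cell of functors `E^(n+1) ⟶ E`, with respect to the variable with
index `0`. -/
noncomputable def daggerCtx {n : ℕ} (α : Cell (Fin (n + 1) → E) E) : Cell (Fin n → E) E :=
  dagger c ((id (LCFunctor.extend E n)).comp α)

theorem daggerCtx_tuple_comp {n m : ℕ} {β : Fin n → Cell (Fin m → E) E}
    {γ : Fin (n + 1) → Cell (Fin (m + 1) → E) E} (hzero : γ 0 = id (LCFunctor.eval 0))
    (hsucc : ∀ i : Fin n, γ i.succ = (weaken E m).comp (β i)) (α : Cell (Fin (n + 1) → E) E) :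
    daggerCtx c ((tuple γ).comp α) = (tuple β).comp (daggerCtx c α) := by
  rw [daggerCtx, ← comp_assoc, extend_comp_tuple hzero hsucc, comp_assoc, dagger_prodRight_comp,
    daggerCtx]

end Dagger

/-- Every component of the 2-cell is an embedding. -/
def IsPointwiseEmbedding {C : Type u₁} [Category.{v₁} C] [OCategory C]
    {D : Type u₂} [Category.{v₂} D] [OCategory D] (α : Cell C D) : Prop :=
  ∀ X, IsEmbedding (α.trans.app X)

namespace IsPointwiseEmbedding

variable {C : Type u₁} [Category.{v₁} C] [OCategory C]
  {D : Type u₂} [Category.{v₂} D] [OCategory D]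

theorem id (F : LCFunctor C D) : (Cell.id F).IsPointwiseEmbedding :=
  fun X => ⟨_, IsEPPair.id (F.obj X)⟩

theorem comp {E : Type u₃} [Category.{v₃} E] [OCategory E] {α : Cell C D} {β : Cell D E}
    (hα : α.IsPointwiseEmbedding) (hβ : β.IsPointwiseEmbedding) :
    (α.comp β).IsPointwiseEmbedding :=
  fun X => IsEmbedding.comp (hβ _) ⟨_, β.tgt.map_isEPPair (hα X).isEPPair⟩

variable {E : Type u} [Category.{v} E] [OCategory E]
  [Limits.HasZeroMorphisms E] [HasStrictMorphisms E] (c : FixChoice E)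

theorem dagger {α : Cell (D × E) E} (hα : α.IsPointwiseEmbedding) :
    (Cell.dagger c α).IsPointwiseEmbedding :=
  fun X => isEmbedding_fixMap c fun Y => hα (X, Y)

theorem daggerCtx {n : ℕ} {α : Cell (Fin (n + 1) → E) E} (hα : α.IsPointwiseEmbedding) :
    (Cell.daggerCtx c α).IsPointwiseEmbedding :=
  dagger c ((id _).comp hα)

end IsPointwiseEmbedding

end Cell

/-! ## Session types -/

section Denotation

variable {E : Type u} [Category.{v} E] [OCategory E]
  [Limits.HasZeroMorphisms E] [HasStrictMorphisms E] (c : FixChoice E)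

/-- The 2-cell denoted by a session type in a single polarity. The recursion is the same for
`⦅A⦆^-` and `⦅A⦆^+`, and makes sense in every O-category with canonical fixed points. -/
noncomputable def denote : {n : ℕ} → SessionType n → Cell (Fin n → E) E
  | _, .var i => .id (.eval i)
  | _, .mu A => .daggerCtx c (denote A)

theorem isPointwiseEmbedding_denote {n : ℕ} (A : SessionType n) :
    (denote c A).IsPointwiseEmbedding := by
  induction A with
  | var i => exact .id _
  | mu A ih => exact .daggerCtx c ih

theorem denote_rename {n m : ℕ} (A : SessionType n) (r : Fin n → Fin m) :
    denote c (A.rename r) = (Cell.tuple fun i => .id (.eval (r i))).comp (denote c A) := by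
  induction A generalizing m with
  | var i => rw [SessionType.rename, denote, denote, Cell.tuple_comp_eval]
  | mu A ih =>
    rw [SessionType.rename, denote, denote, ih]
    refine Cell.daggerCtx_tuple_comp c rfl (fun i => ?_) _
    rw [Cell.weaken, Cell.tuple_comp_eval, Fin.cases_succ]

theorem denote_subst {n m : ℕ} (A : SessionType n) (B : Fin n → SessionType m) :
    denote c (A.subst B) = (Cell.tuple fun i => denote c (B i)).comp (denote c A) := by
  induction A generalizing m with
  | var i => rw [SessionType.subst, denote, Cell.tuple_comp_eval]
  | mu A ih =>
    rw [SessionType.subst, denote, denote, ih]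
    exact Cell.daggerCtx_tuple_comp c rfl (fun i => denote_rename c (B i) Fin.succ) _

end Denotation

section Polarities

/-- The 2-cell `⟦A⟧ ⟶ ⟦A⟧^-` of an interpretation. -/
def Interp.negCell {n : ℕ} (I : Interp.{u} n) : Cell (Ctx.{u} n) ScottDom.{u} :=
  ⟨I.bi, I.neg, I.cellNeg⟩

/-- The 2-cell `⟦A⟧ ⟶ ⟦A⟧^+` of an interpretation. -/
def Interp.posCell {n : ℕ} (I : Interp.{u} n) : Cell (Ctx.{u} n) ScottDom.{u} :=
  ⟨I.bi, I.pos, I.cellPos⟩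

theorem Cell.mk_daggerCtxMap (c : FixChoice ScottDom.{u}) {n : ℕ}
    (α : Cell (Ctx.{u} (n + 1)) ScottDom.{u}) :
    (⟨SessionSem.daggerCtx c α.src, SessionSem.daggerCtx c α.tgt, daggerCtxMap c α.trans⟩ :
      Cell (Ctx.{u} n) ScottDom.{u}) = α.daggerCtx c := by
  rw [Cell.daggerCtx, Cell.id_comp]
  rfl

variable (c : FixChoice ScottDom.{u}) {n m : ℕ}

theorem negCell_interp (A : SessionType n) : (interp c A).negCell = denote c A := by
  induction A with
  | var i => rfl
  | mu A ih => exact (Cell.mk_daggerCtxMap c (interp c A).negCell).trans (congrArg _ ih)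

theorem posCell_interp (A : SessionType n) : (interp c A).posCell = denote c A := by
  induction A with
  | var i => rfl
  | mu A ih => exact (Cell.mk_daggerCtxMap c (interp c A).posCell).trans (congrArg _ ih)

theorem isEmbedding_cell (A : SessionType n) (X : Ctx.{u} n) :
    IsEmbedding ((interp c A).cell.app X) :=
  have hneg : (interp c A).negCell.IsPointwiseEmbedding :=
    (negCell_interp c A).symm ▸ isPointwiseEmbedding_denote c A
  have hpos : (interp c A).posCell.IsPointwiseEmbedding :=
    (posCell_interp c A).symm ▸ isPointwiseEmbedding_denote c A
  ⟨_, ScottDom.isEPPair_lift (hneg X).isEPPair (hpos X).isEPPair⟩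

theorem negCell_subst (A : SessionType n) (B : Fin n → SessionType m) :
    (interp c (A.subst B)).negCell =
      (Cell.tuple fun i => (interp c (B i)).negCell).comp (interp c A).negCell := by
  simp only [negCell_interp, denote_subst]

theorem posCell_subst (A : SessionType n) (B : Fin n → SessionType m) :
    (interp c (A.subst B)).posCell =
      (Cell.tuple fun i => (interp c (B i)).posCell).comp (interp c A).posCell := by
  simp only [posCell_interp, denote_subst]

theorem prodLift_heq {C : Type u₁} [Category.{v₁} C] [OCategory C]
    {F F' N N' P P' : LCFunctor C ScottDom.{u}} {η : F.toFunctor ⟶ N.toFunctor}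
    {θ : F.toFunctor ⟶ P.toFunctor} {η' : F'.toFunctor ⟶ N'.toFunctor}
    {θ' : F'.toFunctor ⟶ P'.toFunctor} (hη : (⟨F, N, η⟩ : Cell C ScottDom.{u}) = ⟨F', N', η'⟩)
    (hθ : (⟨F, P, θ⟩ : Cell C ScottDom.{u}) = ⟨F', P', θ'⟩) :
    prodLift η θ ≍ prodLift η' θ' := by
  cases hη
  cases hθ
  rfl

end Polarities

end SessionSem

theorem mainTheorem8 :
    SupportsCanonicalFixedPoints ScottDom.{u} ∧
    ∀ c : FixChoice ScottDom.{u},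
      (∀ (n : ℕ) (A : SessionType n) (X : Ctx.{u} n), IsEmbedding ((interp c A).cell.app X)) ∧
      ∀ (n m : ℕ) (A : SessionType n) (B : Fin n → SessionType m),
        (interp c (A.subst B)).bi =
          (LCFunctor.tuple fun i => (interp c (B i)).bi).comp (interp c A).bi ∧
        (interp c (A.subst B)).neg =
          (LCFunctor.tuple fun i => (interp c (B i)).neg).comp (interp c A).neg ∧
        (interp c (A.subst B)).pos =
          (LCFunctor.tuple fun i => (interp c (B i)).pos).comp (interp c A).pos ∧
        (interp c (A.subst B)).cell ≍
          prodLift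
            (tupleTrans (fun i => (interp c (B i)).cellNeg) ◫ (interp c A).cellNeg)
            (tupleTrans (fun i => (interp c (B i)).cellPos) ◫ (interp c A).cellPos) := by
  refine ⟨ScottDom.supportsCanonicalFixedPoints, fun c =>
    ⟨fun n A X => isEmbedding_cell c A X, fun n m A B => ?_⟩⟩
  exact ⟨congrArg Cell.src (negCell_subst c A B), congrArg Cell.tgt (negCell_subst c A B),
    congrArg Cell.tgt (posCell_subst c A B),
    prodLift_heq (negCell_subst c A B) (posCell_subst c A B)⟩
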